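/- Let $d\ge 1$ and $p\in[0,1]$. Tile $[-\frac12,\frac12)^d$ by $2^d$ half-open cubes congruent to $[0,\frac12)^d$, keep each of them independently with probability $p$, and let $Z_1$ be the collection of remaining cubes; given $Z_k$, divide each cube of $Z_k$ into $2^d$ half-open cubes congruent to $[0,2^{-k-1})^d$ and keep each of them independently with probability $p$ to obtain $Z_{k+1}$. Let $Q_d(p;n):=\big(\bigcup_{Q\in Z_n}2^nQ\big)\cap\mathbb Z^d$ be the discrete fractal percolation and $Q_d(p):=\bigcap_{n\ge1}\bigcup_{Q\in Z_n}\overline Q$ the continuous fractal percolation. For $\beta>0$ and a closed set $\Lambda\subset[-\frac12,\frac12]^d$ let $$\mathrm{Cap}_\beta(\Lambda):=\Big(\inf_\mu\iint|x-y|^{-\beta}\,\mu(\mathrm dx)\,\mu(\mathrm dy)\Big)^{-1},$$ where the infimum is over all Borel probability measures $\mu$ carried by $\Lambda$, $|\cdot|$ is the Euclidean norm, $|x-y|^{-\beta}=\infty$ for $x=y$, $\inf\emptyset=\infty$ and $\infty^{-1}=0$. Sums of sets are Minkowski sums. Let $d\ge1$ and let $p,q\in(0,1)$ satisfy $p,q>2^{-d}$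 and $\beta:=-\log_2(2^dpq)>0$. Let $Q_d$ and $\widehat Q_d$ denote independent fractal percolations, and write $f\asymp g$ if $C_1g\le f\le C_2g$ with constants $C_1,C_2>0$ depending only on $d,p,q$. Then for every $n\ge1$ and every $A\subset[-2^{n-1},2^{n-1})^d\cap\mathbb Z^d$, $$\mathbb P\big((Q_d(p;n)+\widehat Q_d(q;n))\cap A\ne\emptyset\big)\asymp\mathbb P\big(Q_d(2^dpq;n)\cap A\ne\emptyset\big),$$ with constants independent of $n$ and $A$. Moreover, for every closed set $\Lambda\subset[-\frac12,\frac12]^d$, $$\mathbb P\big((Q_d(p)+\widehat Q_d(q))\cap\Lambda\ne\emptyset\big)\asymp\mathrm{Cap}_\beta(\Lambda)\asymp\mathbb P\big(Q_d(2^dpq)\cap\Lambda\ne\emptyset\big),$$ with constants independent of $\Lambda$. -/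

import Mathlib

open scoped Pointwise ENNReal NNReal

namespace FractalPercolation

/-- The `c`-th cube of generation `n` in the natural tiling of `[-1/2, 1/2)^d` by half-open cubes of
side length `2⁻ⁿ`. It belongs to the tiling when `c i < 2 ^ n` for all `i`; its parent is the cube
of generation `n - 1` with index `i ↦ c i / 2` (rounded down), and the only cube of generation `0`
is `[-1/2, 1/2)^d` itself, with index `0`. -/
def cube {d : ℕ} (n : ℕ) (c : Fin d → ℕ) : Set (EuclideanSpace ℝ (Fin d)) :=
  {x | ∀ i, -(1 / 2 : ℝ) + (c i : ℝ) / 2 ^ n ≤ x i ∧ x i < -(1 / 2 : ℝ) + ((c i : ℝ) + 1) / 2 ^ n}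

/-- `ω` is the set of all pairs `(n, c)` for which the keep-or-discard decision of the `c`-th cube of
generation `n` is "keep". -/
abbrev Decisions (d : ℕ) : Type := Set (ℕ × (Fin d → ℕ))

/-- The law of the decisions: every cube is kept with probability `p`, independently of all others.
(Only `p ∈ [0, 1]` is meaningful; other real numbers are projected to `[0, 1]`.) -/
noncomputable def law (d : ℕ) (p : ℝ) : MeasureTheory.Measure (Decisions d) :=
  ProbabilityTheory.setBernoulli Set.univ (Set.projIcc (0 : ℝ) 1 zero_le_one p)

/-- `remaining ω n` is the collection `Z_n` of (indices of) cubes of generation `n` that remain: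
the initial cube remains, and a cube of generation `n + 1` remains if its parent remains and it is
kept itself. -/
def remaining {d : ℕ} (ω : Decisions d) : ℕ → Set (Fin d → ℕ)
  | 0 => {0}
  | n + 1 => {c | (fun i => c i / 2) ∈ remaining ω n ∧ (n + 1, c) ∈ ω}

/-- The discrete fractal percolation `(⋃_{Q ∈ Z_n} 2ⁿ Q) ∩ ℤ^d`, as a set of integer vectors. -/
def discretePercolation {d : ℕ} (ω : Decisions d) (n : ℕ) : Set (Fin d → ℤ) :=
  {z | WithLp.toLp 2 (fun i => (z i : ℝ)) ∈ ⋃ c ∈ remaining ω n, (2 ^ n : ℝ) • cube n c}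

/-- The (continuous) fractal percolation `⋂_{n ≥ 1} ⋃_{Q ∈ Z_n} closure Q`. -/
def percolation {d : ℕ} (ω : Decisions d) : Set (EuclideanSpace ℝ (Fin d)) :=
  ⋂ n ≥ 1, ⋃ c ∈ remaining ω n, closure (cube n c)

/-- The Newtonian capacity of `Λ ⊆ ℝ^d` with parameter `β`: the inverse of the infimum, over all Borel
probability measures `μ` carried by `Λ`, of the energy `∬ |x - y| ^ (-β) dμ(x) dμ(y)`, where the
integrand is `∞` on the diagonal (for `β > 0`). The infimum is `∞` if no such `μ` exists, and
the inverse of `∞` is `0`. -/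
noncomputable def capacity {d : ℕ} (β : ℝ) (Λ : Set (EuclideanSpace ℝ (Fin d))) : ℝ≥0∞ :=
  (⨅ (μ : MeasureTheory.Measure (EuclideanSpace ℝ (Fin d)))
    (_ : MeasureTheory.IsProbabilityMeasure μ) (_ : μ Λᶜ = 0),
    ∫⁻ x, ∫⁻ y, edist x y ^ (-β) ∂μ ∂μ)⁻¹

end FractalPercolation

/-! The dyadic cubes form a 2^d-ary tree, and all events become percolation on that tree. Give a
vertex of generation k a resistor of conductance p^k. By Lyons' theorem, percolation with parameter
p reaches a set B of leaves with probability comparable to the effective conductance of B, uniformly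
in the depth and in B (`conductance_le_hitProb`, `hitProb_le`). The conductance is bounded above by
the Dirichlet principle and below by Thomson's principle. Both are proved from a single explicit
`potential`, whose drops along any path to B add up to 1. Write r = 2^d p q.

Upper bound for the sum (`law_sum_hit_le`). Fix the second percolation; the first one must then hit
a random set of leaves c with c + c' near B. A trial function for this set is built from the
r-potential of B: its square at u sums the squared potential at v over those v for which v - u is
close to a surviving cube u'. At generation k there are 2^(dk) choices of u, boundedly many u' for
each v, and u' survives with probability q^k. Hence p^k turns into r^k on average, and the expected
energy is at most a constant times the r-conductance of B.

Lower bound for the sum (`conductance_le_law_sumHit`). Apply the second moment method to surviving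
pairs (c, c') with sum a, weighted by the r-equilibrium flow at a. Two pairs whose components branch
at generations j and j' are counted by the deeper level, while their targets are close at the
shallower level. As p, q > 2^(-d), the sum over the gap between the levels is geometric, and what
remains is the r-energy of the flow, which equals the conductance.

Continuous case. By compactness the hitting events are decreasing intersections of events at finite
generation, with B the cubes whose closures meet Λ, so the constants pass to the limit. For
capacity, |x-y|^(-β) is compared with the multiscale kernel summing r^(-k) over the scales at which
x and y share a cube, since 2^β = 1/r. The energy of a measure thereby becomes a flow energy on the
tree. Thomson's principle gives one inequality (`capacity_le_law_percolation_hit`). A weak limit of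
discretized equilibrium flows gives the other (`law_percolation_hit_le_capacity`). -/

namespace FractalPercolation

open MeasureTheory ProbabilityTheory

variable {d : ℕ}

/-! ### The tree of dyadic cubes -/

/-- The ancestor of a vertex of the `2 ^ d`-ary tree, `h` generations up. -/
def anc (h : ℕ) (b : Fin d → ℕ) : Fin d → ℕ := fun i => b i / 2 ^ h

/-- The descendants of a vertex of the `2 ^ d`-ary tree, `m` generations down. -/
def desc (m : ℕ) (c : Fin d → ℕ) : Finset (Fin d → ℕ) :=
  Fintype.piFinset fun i => Finset.Ico (c i * 2 ^ m) ((c i + 1) * 2 ^ m)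

@[simp] lemma anc_zero (b : Fin d → ℕ) : anc 0 b = b := by
  funext i; simp [anc]

lemma anc_anc (h k : ℕ) (b : Fin d → ℕ) : anc h (anc k b) = anc (k + h) b := by
  funext i; simp [anc, Nat.div_div_eq_div_mul, pow_add]

@[simp] lemma mem_desc {m : ℕ} {c v : Fin d → ℕ} : v ∈ desc m c ↔ anc m v = c := by
  simp only [desc, Fintype.mem_piFinset, Finset.mem_Ico, anc, funext_iff]
  refine forall_congr' fun i => ?_
  have h2 : 0 < 2 ^ m := by positivity
  rw [← Nat.le_div_iff_mul_le h2, ← Nat.div_lt_iff_lt_mul h2]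
  omega

lemma desc_zero (c : Fin d → ℕ) : desc 0 c = {c} := by
  ext v; simp

lemma card_desc (m : ℕ) (c : Fin d → ℕ) : (desc m c).card = (2 ^ m) ^ d := by
  simp [desc, Fintype.card_piFinset, ← Nat.sub_mul]

lemma sum_desc_add {M : Type*} [AddCommMonoid M] (j k : ℕ) (c : Fin d → ℕ)
    (f : (Fin d → ℕ) → M) :
    ∑ v ∈ desc (j + k) c, f v = ∑ w ∈ desc k c, ∑ v ∈ desc j w, f v := by
  classical
  rw [← Finset.sum_fiberwise_of_maps_to (s := desc (j + k) c) (t := desc k c) (g := anc j)]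
  · refine Finset.sum_congr rfl fun w hw => Finset.sum_congr ?_ fun _ _ => rfl
    ext v
    simp only [Finset.mem_filter, mem_desc] at hw ⊢
    constructor
    · exact fun h => h.2
    · rintro rfl; exact ⟨by rw [← anc_anc, hw], rfl⟩
  · intro v hv
    simpa [anc_anc] using hv

/-! ### The conductance of a tree and the probability of percolating to its boundary -/

/-- The effective conductance from a vertex of height `m` to the set `B` of leaves. -/
noncomputable def conductance (p : ℝ) (B : Set (Fin d → ℕ)) : ℕ → (Fin d → ℕ) → ℝ
  | 0, c => B.indicator 1 c
  | m + 1, c => p * (∑ w ∈ desc 1 c, conductance p B m w) /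
      (1 + p * ∑ w ∈ desc 1 c, conductance p B m w)

/-- The probability that a vertex of height `m` is connected to the set `B` of leaves. -/
noncomputable def hitProb (p : ℝ) (B : Set (Fin d → ℕ)) : ℕ → (Fin d → ℕ) → ℝ
  | 0, c => B.indicator 1 c
  | m + 1, c => 1 - ∏ w ∈ desc 1 c, (1 - p * hitProb p B m w)

section Conductance

variable {p : ℝ} (hp0 : 0 < p) (hp1 : p < 1) (B : Set (Fin d → ℕ))
include hp0

lemma conductance_mem (m : ℕ) (c : Fin d → ℕ) :
    0 ≤ conductance p B m c ∧ conductance p B m c ≤ 1 := by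
  induction m generalizing c with
  | zero =>
    by_cases h : c ∈ B <;> simp [conductance, h]
  | succ m ih =>
    have hS : 0 ≤ p * ∑ w ∈ desc 1 c, conductance p B m w :=
      mul_nonneg hp0.le (Finset.sum_nonneg fun w _ => (ih w).1)
    simp only [conductance]
    exact ⟨by positivity, by rw [div_le_one (by positivity)]; linarith⟩

include hp1

lemma hitProb_mem (m : ℕ) (c : Fin d → ℕ) :
    0 ≤ hitProb p B m c ∧ hitProb p B m c ≤ 1 := by
  induction m generalizing c with
  | zero =>
    by_cases h : c ∈ B <;> simp [hitProb, h]
  | succ m ih =>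
    have h (w) : 0 ≤ 1 - p * hitProb p B m w ∧ 1 - p * hitProb p B m w ≤ 1 := by
      have := ih w
      constructor <;> nlinarith
    simp only [hitProb]
    have h1 := Finset.prod_le_one (s := desc 1 c) (fun w _ => (h w).1) (fun w _ => (h w).2)
    have h2 := Finset.prod_nonneg (s := desc 1 c) (fun w _ => (h w).1)
    constructor <;> linarith

omit hp0 hp1 in
-- The induction step is (1 - a)(1 + a + S) ≤ 1 + S.
lemma prod_one_sub_le {ι : Type*} (s : Finset ι) (x : ι → ℝ) (h0 : ∀ i ∈ s, 0 ≤ x i)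
    (h1 : ∀ i ∈ s, x i ≤ 1) : ∏ i ∈ s, (1 - x i) ≤ 1 / (1 + ∑ i ∈ s, x i) := by
  classical
  induction s using Finset.induction_on with
  | empty => simp
  | insert a s ha ih =>
    simp only [Finset.mem_insert, forall_eq_or_imp] at h0 h1
    rw [Finset.prod_insert ha, Finset.sum_insert ha]
    have hS : 0 ≤ ∑ i ∈ s, x i := Finset.sum_nonneg h0.2
    refine (mul_le_mul_of_nonneg_left (ih h0.2 h1.2) (by linarith)).trans ?_
    rw [mul_one_div, div_le_div_iff₀ (by positivity) (by linarith [h0.1])]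
    nlinarith [h0.1]

omit hp0 hp1 in
-- The bound on x means 1 - x ≥ φ(t) with φ(t) = (1 - t)/(1 + t), and φ(a)φ(b) ≥ φ(a + b). When the
-- sum of the t exceeds 1 the left side is nonpositive and nothing is needed.
lemma le_prod_one_sub {ι : Type*} (s : Finset ι) (x t : ι → ℝ) (h1 : ∀ i ∈ s, x i ≤ 1)
    (ht : ∀ i ∈ s, 0 ≤ t i) (hx : ∀ i ∈ s, x i ≤ 2 * t i / (1 + t i)) :
    (1 - ∑ i ∈ s, t i) / (1 + ∑ i ∈ s, t i) ≤ ∏ i ∈ s, (1 - x i) := by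
  classical
  induction s using Finset.induction_on with
  | empty => simp
  | insert a s ha ih =>
    simp only [Finset.mem_insert, forall_eq_or_imp] at h1 ht hx
    have hT : 0 ≤ ∑ i ∈ s, t i := Finset.sum_nonneg ht.2
    have ih := ih h1.2 ht.2 hx.2
    rw [Finset.prod_insert ha, Finset.sum_insert ha]
    set T := ∑ i ∈ s, t i
    have hta := ht.1
    rcases le_total 1 (t a + T) with h | h
    · refine (div_nonpos_of_nonpos_of_nonneg (by linarith) (by linarith)).trans ?_
      exact mul_nonneg (by linarith [h1.1])
        (Finset.prod_nonneg fun i hi => by linarith [h1.2 i hi])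
    · have e : (1 - t a) / (1 + t a) ≤ 1 - x a := by
        have : (1 - t a) / (1 + t a) = 1 - 2 * t a / (1 + t a) := by field_simp; ring
        linarith [hx.1]
      refine le_trans ?_ (mul_le_mul e ih (div_nonneg (by linarith) (by linarith))
        (by linarith [h1.1]))
      rw [div_mul_div_comm, div_le_div_iff₀ (by positivity) (by positivity)]
      have : 0 ≤ t a * T * (t a + T) := by positivity
      nlinarith

/-- The recursion for the conductance reads 1 - 1/(1 + S), while the one for the probability is 1
minus a product that `prod_one_sub_le` bounds by 1/(1 + S). -/
lemma conductance_le_hitProb (m : ℕ) (c : Fin d → ℕ) :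
    conductance p B m c ≤ hitProb p B m c := by
  induction m generalizing c with
  | zero => simp [conductance, hitProb]
  | succ m ih =>
    have hS : 0 ≤ ∑ w ∈ desc 1 c, p * conductance p B m w :=
      Finset.sum_nonneg fun w _ => mul_nonneg hp0.le (conductance_mem hp0 B m w).1
    have hle : ∑ w ∈ desc 1 c, p * conductance p B m w ≤ ∑ w ∈ desc 1 c, p * hitProb p B m w :=
      Finset.sum_le_sum fun w _ => mul_le_mul_of_nonneg_left (ih w) hp0.le
    simp only [conductance, hitProb, Finset.mul_sum]
    have h := prod_one_sub_le (desc 1 c) (fun w => p * hitProb p B m w)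
      (fun w _ => mul_nonneg hp0.le (hitProb_mem hp0 hp1 B m w).1)
      (fun w _ => by have := hitProb_mem hp0 hp1 B m w; nlinarith)
    have h2 := one_div_le_one_div_of_le (by linarith)
      (show 1 + ∑ w ∈ desc 1 c, p * conductance p B m w ≤
        1 + ∑ w ∈ desc 1 c, p * hitProb p B m w by linarith)
    have h3 : (∑ w ∈ desc 1 c, p * conductance p B m w) /
      (1 + ∑ w ∈ desc 1 c, p * conductance p B m w) =
        1 - 1 / (1 + ∑ w ∈ desc 1 c, p * conductance p B m w) := by field_simp; ring
    rw [h3]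
    linarith

/-- The term pK in the denominator strengthens the induction hypothesis so that it reproduces
itself. With t = pK/(1 - p) the bound on p times the probability is exactly 2t/(1 + t), the form
required by `le_prod_one_sub`. -/
lemma hitProb_le_aux (m : ℕ) (c : Fin d → ℕ) :
    hitProb p B m c ≤ 2 * conductance p B m c / (1 - p + p * conductance p B m c) := by
  induction m generalizing c with
  | zero => by_cases h : c ∈ B <;> simp [conductance, hitProb, h]
  | succ m ih =>
    have hq : 0 < 1 - p := by linarith
    have hK (w) := conductance_mem hp0 B m w
    have h := le_prod_one_sub (desc 1 c) (fun w => p * hitProb p B m w)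
      (fun w => p * conductance p B m w / (1 - p))
      (fun w _ => by have := hitProb_mem hp0 hp1 B m w; nlinarith)
      (fun w _ => div_nonneg (mul_nonneg hp0.le (hK w).1) hq.le)
      (fun w _ => by
        refine (mul_le_mul_of_nonneg_left (ih w) hp0.le).trans (le_of_eq ?_)
        have := (hK w).1
        have : 0 < 1 - p + p * conductance p B m w := by positivity
        field_simp)
    simp only [← Finset.sum_div, ← Finset.mul_sum] at h
    simp only [conductance, hitProb]
    have hS : 0 ≤ p * ∑ w ∈ desc 1 c, conductance p B m w :=
      mul_nonneg hp0.le (Finset.sum_nonneg fun w _ => (hK w).1)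
    set S := p * ∑ w ∈ desc 1 c, conductance p B m w
    have e1 : (1 - S / (1 - p)) / (1 + S / (1 - p)) = 1 - 2 * S / (1 - p + S) := by
      field_simp
      ring
    have e2 : 2 * (S / (1 + S)) / (1 - p + p * (S / (1 + S))) = 2 * S / (1 - p + S) := by
      have : 1 - p + p * (S / (1 + S)) = (1 - p + S) / (1 + S) := by field_simp; ring
      rw [this]
      field_simp
    rw [e2]
    linarith

lemma hitProb_le (m : ℕ) (c : Fin d → ℕ) :
    hitProb p B m c ≤ 2 / (1 - p) * conductance p B m c := by
  have hq : 0 < 1 - p := by linarith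
  have hK := (conductance_mem hp0 B m c).1
  refine (hitProb_le_aux hp0 hp1 B m c).trans ?_
  rw [div_mul_eq_mul_div]
  exact div_le_div_of_nonneg_left (by positivity) hq (by nlinarith)

end Conductance

/-! ### The equilibrium potential -/

/-- The equilibrium potential of `B`, as a function of height and vertex, in a tree of height `n`. -/
noncomputable def potential (p : ℝ) (B : Set (Fin d → ℕ)) (n h : ℕ) (v : Fin d → ℕ) : ℝ :=
  conductance p B h v * ∏ i ∈ Finset.Ico (h + 1) (n + 1), (1 - conductance p B i (anc (i - h) v))

section Potential

variable {p : ℝ} (hp0 : 0 < p) (B : Set (Fin d → ℕ)) (n : ℕ)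

include hp0 in
lemma potential_nonneg (h : ℕ) (v : Fin d → ℕ) : 0 ≤ potential p B n h v :=
  mul_nonneg (conductance_mem hp0 B h v).1
    (Finset.prod_nonneg fun i _ => by linarith [(conductance_mem hp0 B i (anc (i - h) v)).2])

lemma potential_self (c : Fin d → ℕ) : potential p B n n c = conductance p B n c := by
  simp [potential]

lemma potential_zero_of_notMem {b : Fin d → ℕ} (hb : b ∉ B) : potential p B n 0 b = 0 := by
  simp [potential, conductance, hb]

/-- The drops telescope: the one at height h is R(h + 1) - R(h), where R(h) is the product of 1 - K
over the path from height h up to the root. R vanishes at a leaf of B because K = 1 there. -/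
lemma sum_potential_of_mem {b : Fin d → ℕ} (hb : b ∈ B) :
    ∑ h ∈ Finset.range (n + 1), potential p B n h (anc h b) = 1 := by
  set R : ℕ → ℝ := fun h => ∏ i ∈ Finset.Ico h (n + 1), (1 - conductance p B i (anc i b)) with hR
  have key : ∀ h ∈ Finset.range (n + 1), potential p B n h (anc h b) = R (h + 1) - R h := by
    intro h hh
    rw [Finset.mem_range] at hh
    have e : R (h + 1) = ∏ i ∈ Finset.Ico (h + 1) (n + 1),
        (1 - conductance p B i (anc (i - h) (anc h b))) := by
      refine Finset.prod_congr rfl fun i hi => ?_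
      rw [Finset.mem_Ico] at hi
      rw [anc_anc, show h + (i - h) = i by omega]
    have e2 : R h = (1 - conductance p B h (anc h b)) * R (h + 1) := by
      simp only [hR]
      rw [Finset.prod_eq_prod_Ico_succ_bot hh]
    rw [e2, potential, ← e]
    ring
  rw [Finset.sum_congr rfl key, Finset.sum_range_sub]
  have h0 : R 0 = 0 := by
    refine Finset.prod_eq_zero (i := 0) (by simp) ?_
    simp [conductance, hb]
  have h1 : R (n + 1) = 1 := by simp [hR]
  rw [h0, h1, sub_zero]

include hp0

/-- Kirchhoff's law for the current, which is conductance times potential drop. It is the recursion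
for K rewritten as (1 - K) · pS = K. -/
lemma sum_children_potential {h : ℕ} (hh : h + 1 ≤ n) (v : Fin d → ℕ) :
    ∑ w ∈ desc 1 v, p ^ (n - h) * potential p B n h w =
      p ^ (n - (h + 1)) * potential p B n (h + 1) v := by
  set Q := ∏ i ∈ Finset.Ico (h + 1 + 1) (n + 1), (1 - conductance p B i (anc (i - (h + 1)) v))
  have key : ∀ w ∈ desc 1 v, p ^ (n - h) * potential p B n h w =
      p ^ (n - h) * ((1 - conductance p B (h + 1) v) * Q) * conductance p B h w := by
    intro w hw
    rw [mem_desc] at hw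
    rw [potential, Finset.prod_eq_prod_Ico_succ_bot (by omega), show h + 1 - h = 1 by omega, hw]
    have : Q = ∏ i ∈ Finset.Ico (h + 1 + 1) (n + 1), (1 - conductance p B i (anc (i - h) w)) := by
      refine Finset.prod_congr rfl fun i hi => ?_
      rw [Finset.mem_Ico] at hi
      rw [← hw, anc_anc, show 1 + (i - (h + 1)) = i - h by omega]
    rw [← this]
    ring
  rw [Finset.sum_congr rfl key, ← Finset.mul_sum, potential, show n - h = n - (h + 1) + 1 by omega]
  have hS : 0 ≤ p * ∑ w ∈ desc 1 v, conductance p B h w :=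
    mul_nonneg hp0.le (Finset.sum_nonneg fun w _ => (conductance_mem hp0 B h w).1)
  have hK : (1 - conductance p B (h + 1) v) * (p * ∑ w ∈ desc 1 v, conductance p B h w) =
      conductance p B (h + 1) v := by
    simp only [conductance]
    field_simp
    ring
  rw [pow_succ]
  calc _ = p ^ (n - (h + 1)) * Q * ((1 - conductance p B (h + 1) v) *
        (p * ∑ w ∈ desc 1 v, conductance p B h w)) := by ring
    _ = _ := by rw [hK]; ring

lemma sum_leaves_potential {h : ℕ} (hh : h ≤ n) (v : Fin d → ℕ) :
    ∑ b ∈ desc h v, p ^ n * potential p B n 0 b = p ^ (n - h) * potential p B n h v := by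
  induction h generalizing v with
  | zero => simp [desc_zero]
  | succ h ih =>
    rw [sum_desc_add, ← sum_children_potential hp0 B n hh]
    exact Finset.sum_congr rfl fun w _ => ih (by omega) w

/-- Integrating a function of vertices along paths against the equilibrium flow. -/
lemma sum_flow_path (φ : ℕ → (Fin d → ℕ) → ℝ) (c : Fin d → ℕ) :
    ∑ b ∈ desc n c, p ^ n * potential p B n 0 b * ∑ h ∈ Finset.range (n + 1), φ h (anc h b) =
      ∑ h ∈ Finset.range (n + 1), ∑ v ∈ desc (n - h) c,
        p ^ (n - h) * potential p B n h v * φ h v := by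
  simp_rw [Finset.mul_sum]
  rw [Finset.sum_comm]
  refine Finset.sum_congr rfl fun h hh => ?_
  rw [Finset.mem_range] at hh
  rw [show desc n c = desc (h + (n - h)) c by congr 1; omega, sum_desc_add]
  refine Finset.sum_congr rfl fun v hv => ?_
  rw [← sum_leaves_potential hp0 B n (by omega), Finset.sum_mul]
  refine Finset.sum_congr rfl fun b hb => ?_
  rw [mem_desc] at hb
  rw [hb]

lemma sum_flow (c : Fin d → ℕ) :
    ∑ b ∈ desc n c, p ^ n * potential p B n 0 b = conductance p B n c := by
  rw [sum_leaves_potential hp0 B n le_rfl, potential_self]; simp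

/-- Integrate the potential along paths against its own current: every leaf carrying current sees a
total drop of 1, so the energy equals the strength of the flow. -/
lemma energy_potential (c : Fin d → ℕ) :
    ∑ h ∈ Finset.range (n + 1), ∑ v ∈ desc (n - h) c, p ^ (n - h) * potential p B n h v ^ 2 =
      conductance p B n c := by
  have h := sum_flow_path hp0 B n (potential p B n) c
  rw [← sum_flow hp0 B n c]
  simp_rw [sq, ← mul_assoc]
  rw [← h]
  refine Finset.sum_congr rfl fun b _ => ?_
  by_cases hb : b ∈ B
  · rw [sum_potential_of_mem B n hb, mul_one]
  · rw [potential_zero_of_notMem B n hb]; simp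

/-- The Dirichlet principle: the equilibrium potential minimizes the energy. -/
lemma conductance_le_energy (c : Fin d → ℕ) (ψ : ℕ → (Fin d → ℕ) → ℝ)
    (hψ : ∀ b ∈ B, anc n b = c → 1 ≤ ∑ h ∈ Finset.range (n + 1), ψ h (anc h b)) :
    conductance p B n c ≤
      ∑ h ∈ Finset.range (n + 1), ∑ v ∈ desc (n - h) c, p ^ (n - h) * ψ h v ^ 2 := by
  have h1 : conductance p B n c ≤ ∑ h ∈ Finset.range (n + 1), ∑ v ∈ desc (n - h) c,
        p ^ (n - h) * potential p B n h v * ψ h v := by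
    rw [← sum_flow_path hp0, ← sum_flow hp0 B n c]
    refine Finset.sum_le_sum fun b hb => ?_
    rw [mem_desc] at hb
    by_cases hB : b ∈ B
    · exact le_mul_of_one_le_right
        (mul_nonneg (by positivity) (potential_nonneg hp0 B n 0 b)) (hψ b hB hb)
    · rw [potential_zero_of_notMem B n hB]; simp
  -- Using ab ≤ a²/2 + b²/2 instead of Cauchy–Schwarz lets half of the conductance be absorbed on
  -- the left, with no separate case of conductance zero.
  have h2 : ∑ h ∈ Finset.range (n + 1), ∑ v ∈ desc (n - h) c,
        p ^ (n - h) * potential p B n h v * ψ h v ≤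
      ∑ h ∈ Finset.range (n + 1), ∑ v ∈ desc (n - h) c,
        (p ^ (n - h) * potential p B n h v ^ 2 / 2 + p ^ (n - h) * ψ h v ^ 2 / 2) := by
    refine Finset.sum_le_sum fun h _ => Finset.sum_le_sum fun v _ => ?_
    have : 0 ≤ p ^ (n - h) * (potential p B n h v - ψ h v) ^ 2 := by positivity
    nlinarith
  simp_rw [Finset.sum_add_distrib, ← Finset.sum_div] at h2
  rw [energy_potential hp0] at h2
  linarith

/-- Thomson's principle: the conductance is at least the inverse energy of any unit flow. -/
lemma one_le_conductance_mul_energy (c : Fin d → ℕ) (ν : (Fin d → ℕ) → ℝ)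
    (hν : ∀ b ∉ B, ν b = 0) (hν1 : ∑ b ∈ desc n c, ν b = 1) :
    1 ≤ conductance p B n c * ∑ h ∈ Finset.range (n + 1), ∑ v ∈ desc (n - h) c,
      (p ^ (n - h))⁻¹ * (∑ b ∈ desc h v, ν b) ^ 2 := by
  have h1 : ∑ h ∈ Finset.range (n + 1), ∑ v ∈ desc (n - h) c,
      potential p B n h v * ∑ b ∈ desc h v, ν b = 1 := by
    rw [← hν1]
    have : ∀ b ∈ desc n c, ν b = ∑ h ∈ Finset.range (n + 1), potential p B n h (anc h b) * ν b := by
      intro b _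
      by_cases hb : b ∈ B
      · rw [← Finset.sum_mul, sum_potential_of_mem B n hb, one_mul]
      · simp [hν b hb]
    rw [Finset.sum_congr rfl this, Finset.sum_comm]
    refine Finset.sum_congr rfl fun h hh => ?_
    rw [Finset.mem_range] at hh
    rw [show desc n c = desc (h + (n - h)) c by congr 1; omega, sum_desc_add]
    refine Finset.sum_congr rfl fun v hv => ?_
    rw [Finset.mul_sum]
    refine Finset.sum_congr rfl fun b hb => ?_
    rw [mem_desc] at hb
    rw [hb]
  rw [← energy_potential hp0 B n c]
  simp_rw [Finset.sum_sigma'] at h1 ⊢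
  have := Finset.sum_mul_sq_le_sq_mul_sq
    ((Finset.range (n + 1)).sigma fun h => desc (n - h) c)
    (fun x => √(p ^ (n - x.1)) * potential p B n x.1 x.2)
    (fun x => (√(p ^ (n - x.1)))⁻¹ * ∑ b ∈ desc x.1 x.2, ν b)
  simp only [mul_pow, inv_pow, Real.sq_sqrt (pow_nonneg hp0.le _)] at this
  refine le_trans (le_of_eq ?_) this
  rw [← one_pow 2, ← h1]
  congr 1
  refine Finset.sum_congr rfl fun x _ => ?_
  have : √(p ^ (n - x.1)) ≠ 0 := (Real.sqrt_pos.2 (by positivity)).ne'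
  field_simp

end Potential

/-! ### Independence and the law of the surviving cubes -/

instance (p : ℝ) : IsProbabilityMeasure (law d p) := by
  unfold law; infer_instance

lemma law_subset {p : ℝ} (hp : p ∈ Set.Icc (0 : ℝ) 1) (F : Finset (ℕ × (Fin d → ℕ))) :
    law d p {ω | ∀ x ∈ F, x ∈ ω} = ENNReal.ofReal p ^ F.card := by
  rw [law, setBernoulli_apply', Set.projIcc_of_mem _ hp]
  have : ((fun P : ℕ × (Fin d → ℕ) → Prop => {i | P i}) ⁻¹' {ω : Decisions d | ∀ x ∈ F, x ∈ ω})
      = Set.pi (F : Set _) (fun _ => {True}) := by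
    ext P
    simp [Set.pi]
  rw [this, Measure.infinitePi_pi _ (by intros; trivial)]
  simp only [Measure.add_apply, Measure.smul_apply]
  simp [Set.indicator, ENNReal.smul_def]
  congr 1
  rw [ENNReal.ofReal, ENNReal.coe_inj]
  ext
  simp [hp.1]

lemma law_keep {p : ℝ} (hp : p ∈ Set.Icc (0 : ℝ) 1) (x : ℕ × (Fin d → ℕ)) :
    law d p {ω | x ∈ ω} = ENNReal.ofReal p := by
  simpa using law_subset hp {x}

lemma iIndepSet_keep {p : ℝ} (hp : p ∈ Set.Icc (0 : ℝ) 1) :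
    iIndepSet (fun x : ℕ × (Fin d → ℕ) => {ω : Decisions d | x ∈ ω}) (law d p) := by
  rw [iIndepSet_iff_meas_biInter fun x => measurableSet_mem x]
  intro s
  simp only [law_keep hp, Finset.prod_const]
  rw [← law_subset hp]
  congr 1
  ext ω
  simp

/-- The events that depend only on the decisions for the cubes in `S`. -/
@[reducible] def eventsOf (S : Set (ℕ × (Fin d → ℕ))) : MeasurableSpace (Decisions d) :=
  MeasurableSpace.generateFrom {t | ∃ x ∈ S, {ω : Decisions d | x ∈ ω} = t}

lemma eventsOf_mono {S T : Set (ℕ × (Fin d → ℕ))} (h : S ⊆ T) : eventsOf S ≤ eventsOf T :=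
  MeasurableSpace.generateFrom_mono fun _ ⟨x, hx, e⟩ => ⟨x, h hx, e⟩

lemma eventsOf_le (S : Set (ℕ × (Fin d → ℕ))) :
    eventsOf S ≤ (inferInstance : MeasurableSpace (Decisions d)) :=
  MeasurableSpace.generateFrom_le fun _ ⟨x, _, e⟩ => e ▸ measurableSet_mem x

lemma measurableSet_eventsOf {S : Set (ℕ × (Fin d → ℕ))} {x} (hx : x ∈ S) :
    MeasurableSet[eventsOf S] {ω : Decisions d | x ∈ ω} :=
  MeasurableSpace.measurableSet_generateFrom ⟨x, hx, rfl⟩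

lemma law_inter {p : ℝ} (hp : p ∈ Set.Icc (0 : ℝ) 1) {S T : Set (ℕ × (Fin d → ℕ))}
    (h : Disjoint S T) {E F : Set (Decisions d)} (hE : MeasurableSet[eventsOf S] E)
    (hF : MeasurableSet[eventsOf T] F) :
    (law d p).real (E ∩ F) = (law d p).real E * (law d p).real F := by
  have := (Indep_iff _ _ _).1 (iIndepSet.indep_generateFrom_of_disjoint
    (fun x => measurableSet_mem x) (iIndepSet_keep hp) S T h) E F hE hF
  simp [Measure.real, this, ENNReal.toReal_mul]

/-- The event that the cube `c` of generation `k` is connected to a cube in `B`, `m` generations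
below, by a path of kept cubes. -/
def connected (B : Set (Fin d → ℕ)) : ℕ → ℕ → (Fin d → ℕ) → Set (Decisions d)
  | _, 0, c => {_ω | c ∈ B}
  | k, m + 1, c => ⋃ w ∈ desc 1 c, {ω | (k + 1, w) ∈ ω} ∩ connected B (k + 1) m w

lemma mem_connected {B : Set (Fin d → ℕ)} {k m : ℕ} {c : Fin d → ℕ} {ω : Decisions d} :
    ω ∈ connected B k m c ↔
      ∃ b ∈ B, anc m b = c ∧ ∀ j < m, (k + m - j, anc j b) ∈ ω := by
  induction m generalizing k c with
  | zero => simp [connected]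
  | succ m ih =>
    simp only [connected, Set.mem_iUnion, mem_desc, Set.mem_inter_iff, Set.mem_ofPred_eq, ih]
    constructor
    · rintro ⟨w, rfl, hw, b, hb, rfl, h⟩
      refine ⟨b, hb, (anc_anc _ _ _).symm, fun j hj => ?_⟩
      rcases Nat.lt_succ_iff_lt_or_eq.1 hj with hj | rfl
      · convert h j hj using 2; omega
      · convert hw using 2; omega
    · rintro ⟨b, hb, rfl, h⟩
      refine ⟨anc m b, anc_anc _ _ _, ?_, b, hb, rfl, fun j hj => ?_⟩
      · convert h m (by omega) using 2; omega
      · convert h j (by omega) using 2; omega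

lemma mem_remaining {ω : Decisions d} {n : ℕ} {c : Fin d → ℕ} :
    c ∈ remaining ω n ↔ anc n c = 0 ∧ ∀ j < n, (n - j, anc j c) ∈ ω := by
  induction n generalizing c with
  | zero => simp [remaining]
  | succ n ih =>
    have e : (fun i => c i / 2) = anc 1 c := by funext i; simp [anc]
    simp only [remaining, Set.mem_ofPred_eq, e, ih, anc_anc, Nat.add_comm 1]
    constructor
    · rintro ⟨⟨h0, h⟩, h1⟩
      refine ⟨h0, fun j hj => ?_⟩
      rcases j with _ | j
      · simpa using h1
      · simpa using h j (by omega)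
    · rintro ⟨h0, h⟩
      exact ⟨⟨h0, fun j hj => by simpa using h (j + 1) (by omega)⟩, by simpa using h 0 (by omega)⟩

lemma connected_root (B : Set (Fin d → ℕ)) (n : ℕ) :
    connected B 0 n 0 = {ω | ∃ c ∈ remaining ω n, c ∈ B} := by
  ext ω
  simp only [mem_connected, Set.mem_ofPred_eq, mem_remaining, zero_add]
  exact ⟨fun ⟨b, h1, h2⟩ => ⟨b, h2, h1⟩, fun ⟨b, h2, h1⟩ => ⟨b, h1, h2⟩⟩

lemma measurableSet_connected (B : Set (Fin d → ℕ)) (k m : ℕ) (c : Fin d → ℕ) :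
    MeasurableSet[eventsOf {x | k < x.1 ∧ anc (x.1 - k) x.2 = c}] (connected B k m c) := by
  induction m generalizing k c with
  | zero => by_cases h : c ∈ B <;> simp [connected, h]
  | succ m ih =>
    refine Finset.measurableSet_biUnion _ fun w hw => ?_
    rw [mem_desc] at hw
    refine MeasurableSet.inter (measurableSet_eventsOf (by simpa using hw)) ?_
    refine eventsOf_mono (fun x hx => ?_) _ (ih (k + 1) w)
    obtain ⟨h1, h2⟩ := hx
    refine ⟨by omega, ?_⟩
    rw [← hw, ← h2, anc_anc]
    congr 1
    omega

/-- The events attached to different children depend on disjoint sets of decisions, so the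
probabilities of their complements multiply. This is the recursion defining `hitProb`. -/
lemma law_connected {p : ℝ} (hp : p ∈ Set.Icc (0 : ℝ) 1) (B : Set (Fin d → ℕ)) (k m : ℕ)
    (c : Fin d → ℕ) : (law d p).real (connected B k m c) = hitProb p B m c := by
  induction m generalizing k c with
  | zero => by_cases h : c ∈ B <;> simp [connected, hitProb, h]
  | succ m ih =>
    set E : (Fin d → ℕ) → Set (Decisions d) :=
      fun w => {ω | (k + 1, w) ∈ ω} ∩ connected B (k + 1) m w with hE
    set T : (Fin d → ℕ) → Set (ℕ × (Fin d → ℕ)) :=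
      fun w => {x | k + 1 ≤ x.1 ∧ anc (x.1 - (k + 1)) x.2 = w} with hT
    have hET : ∀ w, MeasurableSet[eventsOf (T w)] (E w) := by
      intro w
      refine MeasurableSet.inter (measurableSet_eventsOf ?_) ?_
      · simp [hT]
      · refine eventsOf_mono ?_ _ (measurableSet_connected B (k + 1) m w)
        exact fun x hx => ⟨hx.1.le, hx.2⟩
    have hEm : ∀ w, (law d p).real (E w) = p * hitProb p B m w := by
      intro w
      rw [hE, law_inter hp (S := {(k + 1, w)}) ?_ (measurableSet_eventsOf rfl)
        (measurableSet_connected B (k + 1) m w), ih, Measure.real, law_keep hp,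
        ENNReal.toReal_ofReal hp.1]
      rw [Set.disjoint_singleton_left]
      simp
    have key : ∀ s : Finset (Fin d → ℕ), (law d p).real (⋂ w ∈ s, (E w)ᶜ) =
        ∏ w ∈ s, (1 - p * hitProb p B m w) := by
      intro s
      classical
      induction s using Finset.induction_on with
      | empty => simp
      | insert a s ha ihs =>
        have hdis : Disjoint (T a) (⋃ w ∈ s, T w) := by
          simp only [Set.disjoint_iUnion_right]
          intro w hw
          rw [Set.disjoint_left]
          rintro x ⟨_, h1⟩ ⟨_, h2⟩
          exact ha (h1 ▸ h2 ▸ hw)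
        have hmeas : MeasurableSet[eventsOf (⋃ w ∈ s, T w)] (⋂ w ∈ s, (E w)ᶜ) := by
          refine Finset.measurableSet_biInter _ fun w hw => ?_
          exact eventsOf_mono (Set.subset_biUnion_of_mem (u := T) (Finset.mem_coe.2 hw)) _
            (hET w).compl
        rw [Finset.prod_insert ha, Finset.set_biInter_insert,
          law_inter hp (S := T a) (T := ⋃ w ∈ s, T w) hdis (hET a).compl hmeas, ihs,
          probReal_compl_eq_one_sub (eventsOf_le _ _ (hET a)), hEm]
    have h := key (desc 1 c)
    rw [show (⋂ w ∈ desc 1 c, (E w)ᶜ) = (connected B k (m + 1) c)ᶜ by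
      simp [connected, hE, Set.compl_iUnion], probReal_compl_eq_one_sub
      (eventsOf_le _ _ (measurableSet_connected B k (m + 1) c))] at h
    rw [hitProb]
    linarith

/-- The probability that the percolation process hits a set of cubes. -/
lemma law_hit {p : ℝ} (hp : p ∈ Set.Icc (0 : ℝ) 1) (B : Set (Fin d → ℕ)) (n : ℕ) :
    law d p {ω | ∃ c ∈ remaining ω n, c ∈ B} = ENNReal.ofReal (hitProb p B n 0) := by
  rw [← law_connected hp B 0 n 0, connected_root, ofReal_measureReal]

lemma measurableSet_remaining (n : ℕ) (c : Fin d → ℕ) :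
    MeasurableSet {ω : Decisions d | c ∈ remaining ω n} := by
  simp only [mem_remaining]
  have : {ω : Decisions d | anc n c = 0 ∧ ∀ j < n, (n - j, anc j c) ∈ ω} =
      {_ω | anc n c = 0} ∩ ⋂ j, ⋂ (_ : j < n), {ω | (n - j, anc j c) ∈ ω} := by
    ext ω; simp
  rw [this]
  exact (MeasurableSet.const _).inter
    (MeasurableSet.iInter fun j => MeasurableSet.iInter fun _ => measurableSet_mem _)

/-- The cubes that have to be kept for `c` to remain in generation `n`. -/
def path (n : ℕ) (c : Fin d → ℕ) : Finset (ℕ × (Fin d → ℕ)) :=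
  (Finset.range n).image fun j => (j + 1, anc (n - (j + 1)) c)

lemma card_path (n : ℕ) (c : Fin d → ℕ) : (path n c).card = n := by
  rw [path, Finset.card_image_of_injective, Finset.card_range]
  intro a b h
  simpa using (Prod.ext_iff.1 h).1

lemma mem_path {n : ℕ} {c : Fin d → ℕ} {x : ℕ × (Fin d → ℕ)} :
    x ∈ path n c ↔ 1 ≤ x.1 ∧ x.1 ≤ n ∧ anc (n - x.1) c = x.2 := by
  simp only [path, Finset.mem_image, Finset.mem_range]
  constructor
  · rintro ⟨j, hj, rfl⟩
    exact ⟨by simp, by simpa using hj, rfl⟩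
  · rintro ⟨h1, h2, h3⟩
    refine ⟨x.1 - 1, by omega, ?_⟩
    ext1
    · change x.1 - 1 + 1 = x.1; omega
    · rw [← h3]; change anc (n - (x.1 - 1 + 1)) c = _; congr 1; omega

lemma mem_remaining_iff_path {ω : Decisions d} {n : ℕ} {c : Fin d → ℕ} :
    c ∈ remaining ω n ↔ c ∈ desc n (0 : Fin d → ℕ) ∧ ∀ x ∈ path n c, x ∈ ω := by
  rw [mem_remaining, mem_desc]
  refine and_congr_right fun _ => ⟨fun h x hx => ?_, fun h j hj => h _ ?_⟩
  · rw [mem_path] at hx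
    have := h (n - x.1) (by omega)
    rw [hx.2.2, show n - (n - x.1) = x.1 by omega] at this
    exact this
  · rw [mem_path]
    refine ⟨by simp only; omega, by simp, ?_⟩
    congr 1
    simp only
    omega

lemma law_remaining {p : ℝ} (hp : p ∈ Set.Icc (0 : ℝ) 1) {n : ℕ} {c : Fin d → ℕ}
    (hc : c ∈ desc n (0 : Fin d → ℕ)) :
    law d p {ω | c ∈ remaining ω n} = ENNReal.ofReal p ^ n := by
  simp only [mem_remaining_iff_path, hc, true_and]
  rw [law_subset hp, card_path]

/-- Here j is the number of cubes common to the two ancestral paths, so that 2n - j decisions must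
be favourable. -/
lemma law_remaining_pair {p : ℝ} (hp : p ∈ Set.Ioo (0 : ℝ) 1) {n : ℕ} {c e : Fin d → ℕ}
    (hc : c ∈ desc n (0 : Fin d → ℕ)) (he : e ∈ desc n (0 : Fin d → ℕ)) :
    ∃ j ≤ n, anc (n - j) c = anc (n - j) e ∧
      (law d p).real {ω | c ∈ remaining ω n ∧ e ∈ remaining ω n} = p ^ (2 * n) * (p ^ j)⁻¹ := by
  classical
  simp only [mem_remaining_iff_path, hc, he, true_and]
  have e1 : {ω : Decisions d | (∀ x ∈ path n c, x ∈ ω) ∧ ∀ x ∈ path n e, x ∈ ω} =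
      {ω | ∀ x ∈ path n c ∪ path n e, x ∈ ω} := by
    ext ω
    simp only [Set.mem_ofPred_eq, Finset.mem_union]
    exact ⟨fun h x hx => hx.elim (h.1 x) (h.2 x), fun h => ⟨fun x hx => h x (.inl hx),
      fun x hx => h x (.inr hx)⟩⟩
  have hcard := Finset.card_union_add_card_inter (path n c) (path n e)
  simp only [card_path] at hcard
  set j := (path n c ∩ path n e).card with hj
  have hjn : j ≤ n := by
    exact (Finset.card_le_card Finset.inter_subset_left).trans (card_path n c).le
  refine ⟨j, hjn, ?_, ?_⟩
  · rcases Nat.eq_zero_or_pos j with h0 | h0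
    · rw [h0, Nat.sub_zero]
      rw [mem_desc] at hc he
      rw [hc, he]
    · -- the common part of the paths has a cube of generation at least `j`
      have : ∃ x ∈ path n c ∩ path n e, j ≤ x.1 := by
        by_contra! hlt
        -- Common cubes lie in distinct generations, all at least 1, so j of them do not fit into
        -- generations 1, …, j - 1.
        have hsub : (path n c ∩ path n e).image Prod.fst ⊆ Finset.Ico 1 j := by
          intro l hl
          obtain ⟨x, hx, rfl⟩ := Finset.mem_image.1 hl
          exact Finset.mem_Ico.2 ⟨(mem_path.1 (Finset.mem_inter.1 hx).1).1, hlt x hx⟩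
        have h2 := Finset.card_le_card hsub
        rw [Finset.card_image_of_injOn, Nat.card_Ico, ← hj] at h2
        · omega
        · intro x hx y hy hxy
          have hx := (mem_path.1 (Finset.mem_inter.1 hx).1).2.2
          have hy := (mem_path.1 (Finset.mem_inter.1 hy).1).2.2
          ext1
          · exact hxy
          · rw [← hx, ← hy, hxy]
      obtain ⟨x, hx, hjx⟩ := this
      rw [Finset.mem_inter, mem_path, mem_path] at hx
      have := congrArg (anc (x.1 - j)) (hx.1.2.2.trans hx.2.2.2.symm)
      rw [anc_anc, anc_anc] at this
      have hx1 := hx.1.2.1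
      rwa [show n - x.1 + (x.1 - j) = n - j by omega] at this
  · rw [e1, Measure.real, law_subset ⟨hp.1.le, hp.2.le⟩, ENNReal.toReal_pow,
      ENNReal.toReal_ofReal hp.1.le, ← div_eq_mul_inv, eq_div_iff (pow_pos hp.1 _).ne', ← pow_add,
      hcard, two_mul]

/-! ### Upper bound for the sum: a random trial potential -/

lemma card_filter_le (s : Finset (Fin d → ℕ)) (P : (Fin d → ℕ) → Prop) [DecidablePred P]
    (a : Fin d → ℤ) (m : ℕ) (hP : ∀ u, P u → ∀ i, a i ≤ u i ∧ (u i : ℤ) ≤ a i + m) :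
    (s.filter P).card ≤ (m + 1) ^ d := by
  have hsub : s.filter P ⊆
      Fintype.piFinset fun i => (Finset.Icc (a i) (a i + m)).image Int.toNat := by
    intro u hu
    rw [Fintype.mem_piFinset]
    intro i
    have := hP u (Finset.mem_filter.1 hu).2 i
    exact Finset.mem_image.2 ⟨u i, Finset.mem_Icc.2 this, by simp⟩
  refine (Finset.card_le_card hsub).trans ?_
  rw [Fintype.card_piFinset]
  refine (Finset.prod_le_pow_card _ _ (m + 1) fun i _ => ?_).trans (by simp)
  refine Finset.card_image_le.trans ?_
  rw [Int.card_Icc]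
  omega

/-- The cubes `c`, `c'` of generation `k` are such that their sum is, up to an error of `e / 2` cubes,
the cube `v`. -/
def SumNear (e : ℤ) (k : ℕ) (c c' v : Fin d → ℕ) : Prop :=
  ∀ i, |2 * ((c i : ℤ) + c' i - v i) - 2 ^ k| ≤ e

/-- Rounding down by T = 2^h changes the doubled quantity by less than 4T, so the scaled error is at
most 8T. Doubling in `SumNear` keeps the offset 2^k/2 integral even at generation 0. -/
lemma SumNear.anc {n h : ℕ} (hh : h ≤ n) {c c' v : Fin d → ℕ} (H : SumNear 4 n c c' v) :
    SumNear 8 (n - h) (anc h c) (anc h c') (anc h v) := by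
  intro i
  have hi := abs_le.1 (H i)
  have e1 := Nat.div_add_mod (c i) (2 ^ h)
  have e2 := Nat.div_add_mod (c' i) (2 ^ h)
  have e3 := Nat.div_add_mod (v i) (2 ^ h)
  have l1 := Nat.mod_lt (c i) (show 0 < 2 ^ h by positivity)
  have l2 := Nat.mod_lt (c' i) (show 0 < 2 ^ h by positivity)
  have l3 := Nat.mod_lt (v i) (show 0 < 2 ^ h by positivity)
  simp only [FractalPercolation.anc]
  zify at e1 e2 e3 l1 l2 l3
  have p1 : (0 : ℤ) ≤ (c i : ℤ) % 2 ^ h := Int.emod_nonneg _ (by positivity)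
  have p2 : (0 : ℤ) ≤ (c' i : ℤ) % 2 ^ h := Int.emod_nonneg _ (by positivity)
  have p3 : (0 : ℤ) ≤ (v i : ℤ) % 2 ^ h := Int.emod_nonneg _ (by positivity)
  have hT : (1 : ℤ) ≤ 2 ^ h := one_le_pow₀ (by norm_num)
  have hn : (2 : ℤ) ^ n = 2 ^ h * 2 ^ (n - h) := by rw [← pow_add]; congr 1; omega
  push_cast
  set T : ℤ := 2 ^ h
  set x := (c i : ℤ) / T
  set y := (c' i : ℤ) / T
  set z := (v i : ℤ) / T
  rw [← e1, ← e2, ← e3, hn] at hi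
  have hi1 : -(8 * T) ≤ T * (2 * (x + y - z) - 2 ^ (n - h)) := by nlinarith [hi.1]
  have hi2 : T * (2 * (x + y - z) - 2 ^ (n - h)) ≤ 8 * T := by nlinarith [hi.2]
  rw [abs_le]
  constructor <;> by_contra! hlt <;> nlinarith

lemma anc_mem_remaining {ω : Decisions d} {n h : ℕ} (hh : h ≤ n) {c : Fin d → ℕ}
    (hc : c ∈ remaining ω n) : anc h c ∈ remaining ω (n - h) := by
  rw [mem_remaining] at hc ⊢
  rw [anc_anc, show h + (n - h) = n by omega]
  refine ⟨hc.1, fun j hj => ?_⟩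
  rw [anc_anc]
  convert hc.2 (h + j) (by omega) using 2
  omega

lemma mem_box_of_mem_remaining {ω : Decisions d} {n : ℕ} {c : Fin d → ℕ}
    (hc : c ∈ remaining ω n) : c ∈ desc n (0 : Fin d → ℕ) :=
  mem_desc.2 (mem_remaining.1 hc).1

lemma card_sumNear_le (k : ℕ) (s : Finset (Fin d → ℕ)) (u v : Fin d → ℕ)
    [DecidablePred fun u' => SumNear 8 k u u' v] :
    (s.filter fun u' => SumNear 8 k u u' v).card ≤ 9 ^ d := by
  -- The left endpoint is half of 2^k - 2(u - v) - 8 rounded up; at most nine integers are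
  -- admissible in each coordinate.
  refine card_filter_le s _ (fun i => (2 ^ k - 2 * ((u i : ℤ) - v i) - 7) / 2) 8 fun u' h i => ?_
  have := abs_le.1 (h i)
  constructor <;> push_cast <;> omega

/-- The random potential used to bound the conductance of the difference of a set with a
percolation. -/
lemma conductance_sum_le {p r : ℝ} (hp0 : 0 < p) (n : ℕ) (B : Set (Fin d → ℕ))
    (hB : B ⊆ desc n (0 : Fin d → ℕ)) (ω : Decisions d)
    [∀ k u v, DecidablePred fun u' : Fin d → ℕ => SumNear 8 k u u' v] :
    conductance p {c | ∃ c' ∈ remaining ω n, ∃ a ∈ B, SumNear 4 n c c' a} n 0 ≤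
      ∑ h ∈ Finset.range (n + 1), ∑ u ∈ desc (n - h) (0 : Fin d → ℕ),
        ∑ v ∈ desc (n - h) (0 : Fin d → ℕ),
          ∑ u' ∈ (desc (n - h) (0 : Fin d → ℕ)).filter fun u' => SumNear 8 (n - h) u u' v,
            p ^ (n - h) * potential r B n h v ^ 2 *
              {ω : Decisions d | u' ∈ remaining ω (n - h)}.indicator 1 ω := by
  -- The square root makes ψ² linear in the survival indicators, so that the expected energy can be
  -- computed term by term.
  set ψ : ℕ → (Fin d → ℕ) → ℝ := fun h u => √(∑ v ∈ desc (n - h) (0 : Fin d → ℕ),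
    ∑ u' ∈ (desc (n - h) (0 : Fin d → ℕ)).filter fun u' => SumNear 8 (n - h) u u' v,
      potential r B n h v ^ 2 * {ω : Decisions d | u' ∈ remaining ω (n - h)}.indicator 1 ω) with hψ
  have hnn : ∀ h (v u' : Fin d → ℕ), 0 ≤ potential r B n h v ^ 2 *
      {ω : Decisions d | u' ∈ remaining ω (n - h)}.indicator (1 : Decisions d → ℝ) ω := fun h v u' =>
    mul_nonneg (sq_nonneg _) (Set.indicator_nonneg (fun _ _ => zero_le_one) _)
  refine (conductance_le_energy hp0 _ n 0 ψ ?_).trans (le_of_eq ?_)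
  -- Admissibility: at each height, the term with v and u' the ancestors of a and c' already makes ψ
  -- at least the potential at v. Those potentials sum to 1 along the path to a.
  · rintro c ⟨c', hc', a, ha, hnear⟩ hc
    rw [← sum_potential_of_mem (p := r) B n ha]
    refine Finset.sum_le_sum fun h hh => ?_
    rw [Finset.mem_range] at hh
    refine Real.le_sqrt_of_sq_le ?_
    have hbox : ∀ x ∈ desc n (0 : Fin d → ℕ), anc h x ∈ desc (n - h) (0 : Fin d → ℕ) := by
      intro x hx
      rw [mem_desc] at hx ⊢
      rw [anc_anc, show h + (n - h) = n by omega, hx]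
    have hrem := anc_mem_remaining (show h ≤ n by omega) hc'
    refine le_trans ?_ (Finset.single_le_sum (f := fun v => ∑ u' ∈ (desc (n - h)
      (0 : Fin d → ℕ)).filter fun u' => SumNear 8 (n - h) (anc h c) u' v, potential r B n h v ^ 2 *
        {ω : Decisions d | u' ∈ remaining ω (n - h)}.indicator (1 : Decisions d → ℝ) ω)
      (fun v _ => Finset.sum_nonneg fun u' _ => hnn h v u') (hbox a (hB ha)))
    refine le_trans ?_ (Finset.single_le_sum (f := fun u' => potential r B n h (anc h a) ^ 2 *
        {ω : Decisions d | u' ∈ remaining ω (n - h)}.indicator (1 : Decisions d → ℝ) ω)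
      (fun u' _ => hnn h _ u') (Finset.mem_filter.2 ⟨mem_box_of_mem_remaining hrem,
        hnear.anc (by omega)⟩))
    simp [hrem]
  · refine Finset.sum_congr rfl fun h _ => Finset.sum_congr rfl fun u _ => ?_
    rw [hψ, Real.sq_sqrt (Finset.sum_nonneg fun v _ => Finset.sum_nonneg fun u' _ => hnn h v u')]
    simp_rw [Finset.mul_sum, ← mul_assoc]

lemma measurableSet_sum_hit (n : ℕ) (R : (Fin d → ℕ) → (Fin d → ℕ) → Prop) :
    MeasurableSet {ω : Decisions d × Decisions d | ∃ c ∈ remaining ω.1 n, ∃ c' ∈ remaining ω.2 n,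
      R c c'} := by
  have : {ω : Decisions d × Decisions d | ∃ c ∈ remaining ω.1 n, ∃ c' ∈ remaining ω.2 n,
      R c c'} = ⋃ c, ⋃ c', ⋃ (_ : R c c'),
        Prod.fst ⁻¹' {ω | c ∈ remaining ω n} ∩ Prod.snd ⁻¹' {ω | c' ∈ remaining ω n} := by
    ext ω
    simp only [Set.mem_ofPred_eq, Set.mem_iUnion, Set.mem_inter_iff, Set.mem_preimage]
    constructor
    · rintro ⟨c, h1, c', h2, h3⟩; exact ⟨c, c', h3, h1, h2⟩
    · rintro ⟨c, c', h3, h1, h2⟩; exact ⟨c, h1, c', h2, h3⟩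
  rw [this]
  exact .iUnion fun c => .iUnion fun c' => .iUnion fun _ =>
    (measurable_fst (measurableSet_remaining n c)).inter
      (measurable_snd (measurableSet_remaining n c'))

theorem law_sum_hit_le {p q r : ℝ} (hp : p ∈ Set.Ioo (0 : ℝ) 1) (hq : q ∈ Set.Ioo (0 : ℝ) 1)
    (hr : r = 2 ^ d * p * q) (hr1 : r < 1) (n : ℕ) (B : Set (Fin d → ℕ))
    (hB : B ⊆ desc n (0 : Fin d → ℕ)) :
    ((law d p).prod (law d q)) {ω | ∃ c ∈ remaining ω.1 n, ∃ c' ∈ remaining ω.2 n,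
      ∃ a ∈ B, SumNear 4 n c c' a} ≤
      ENNReal.ofReal (2 / (1 - p) * 9 ^ d) * law d r {ω | ∃ c ∈ remaining ω n, c ∈ B} := by
  classical
  have hp1 : 0 < 1 - p := by linarith [hp.2]
  have hr0 : 0 < r := by rw [hr]; have := hp.1; have := hq.1; positivity
  set C := 2 / (1 - p) with hC
  have hC0 : 0 ≤ C := by positivity
  have hnn : ∀ h (v : Fin d → ℕ), 0 ≤ C * (p ^ (n - h) * potential r B n h v ^ 2) :=
    fun h v => by have := hp.1; positivity
  -- Condition on the second percolation, which turns the set to be hit by the first one into a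
  -- deterministic set.
  rw [Measure.prod_apply_symm
    (measurableSet_sum_hit n fun c c' => ∃ a ∈ B, SumNear 4 n c c' a)]
  have hpt : ∀ ω₂ : Decisions d, law d p ((fun ω₁ => (ω₁, ω₂)) ⁻¹' {ω | ∃ c ∈ remaining ω.1 n,
      ∃ c' ∈ remaining ω.2 n, ∃ a ∈ B, SumNear 4 n c c' a}) ≤
      ∑ h ∈ Finset.range (n + 1), ∑ u ∈ desc (n - h) (0 : Fin d → ℕ),
        ∑ v ∈ desc (n - h) (0 : Fin d → ℕ),
          ∑ u' ∈ (desc (n - h) (0 : Fin d → ℕ)).filter fun u' => SumNear 8 (n - h) u u' v,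
            ENNReal.ofReal (C * (p ^ (n - h) * potential r B n h v ^ 2)) *
              {ω : Decisions d | u' ∈ remaining ω (n - h)}.indicator 1 ω₂ := by
    intro ω₂
    have h1 := law_hit ⟨hp.1.le, hp.2.le⟩
      {c | ∃ c' ∈ remaining ω₂ n, ∃ a ∈ B, SumNear 4 n c c' a} n
    have h2 := (hitProb_le hp.1 hp.2 {c | ∃ c' ∈ remaining ω₂ n, ∃ a ∈ B, SumNear 4 n c c' a}
      n 0).trans (mul_le_mul_of_nonneg_left (conductance_sum_le (r := r) hp.1 n B hB ω₂) hC0)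
    refine h1.le.trans ((ENNReal.ofReal_le_ofReal h2).trans (le_of_eq ?_))
    simp_rw [Finset.mul_sum, ← mul_assoc]
    have hind : ∀ (h : ℕ) (u' : Fin d → ℕ), (0 : ℝ) ≤
        {ω : Decisions d | u' ∈ remaining ω (n - h)}.indicator 1 ω₂ :=
      fun h u' => Set.indicator_nonneg (fun _ _ => zero_le_one) _
    simp only [mul_assoc] at hnn ⊢
    have hnn' : ∀ h (v u' : Fin d → ℕ), 0 ≤ C * (p ^ (n - h) * (potential r B n h v ^ 2 *
        {ω : Decisions d | u' ∈ remaining ω (n - h)}.indicator 1 ω₂)) := fun h v u' => by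
      have := mul_nonneg (hnn h v) (hind h u')
      simpa only [mul_assoc] using this
    rw [ENNReal.ofReal_sum_of_nonneg fun h _ => Finset.sum_nonneg fun u _ =>
      Finset.sum_nonneg fun v _ => Finset.sum_nonneg fun u' _ => hnn' h v u']
    refine Finset.sum_congr rfl fun h _ => ?_
    rw [ENNReal.ofReal_sum_of_nonneg fun u _ =>
      Finset.sum_nonneg fun v _ => Finset.sum_nonneg fun u' _ => hnn' h v u']
    refine Finset.sum_congr rfl fun u _ => ?_
    rw [ENNReal.ofReal_sum_of_nonneg fun v _ => Finset.sum_nonneg fun u' _ => hnn' h v u']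
    refine Finset.sum_congr rfl fun v _ => ?_
    rw [ENNReal.ofReal_sum_of_nonneg fun u' _ => hnn' h v u']
    refine Finset.sum_congr rfl fun u' _ => ?_
    by_cases hu : u' ∈ remaining ω₂ (n - h) <;> simp [hu]
  refine (lintegral_mono hpt).trans ?_
  have hmeas : ∀ (h : ℕ) (u' v : Fin d → ℕ), Measurable fun ω₂ : Decisions d =>
      ENNReal.ofReal (C * (p ^ (n - h) * potential r B n h v ^ 2)) *
        {ω : Decisions d | u' ∈ remaining ω (n - h)}.indicator (1 : Decisions d → ℝ≥0∞) ω₂ := fun h u' v =>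
    (measurable_one.indicator (measurableSet_remaining _ _)).const_mul _
  rw [lintegral_finsetSum _ fun h _ => Finset.measurable_sum _ fun u _ =>
    Finset.measurable_sum _ fun v _ => Finset.measurable_sum _ fun u' _ => hmeas h u' v]
  -- At generation k = n - h: there are 2^(dk) cubes u, at most 9^d cubes u' for given u and v, and
  -- survival probability q^k. The factor p^k · 2^(dk) · q^k is r^k.
  have hlevel : ∀ h ∈ Finset.range (n + 1), ∫⁻ ω₂, ∑ u ∈ desc (n - h) (0 : Fin d → ℕ),
        ∑ v ∈ desc (n - h) (0 : Fin d → ℕ),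
          ∑ u' ∈ (desc (n - h) (0 : Fin d → ℕ)).filter fun u' => SumNear 8 (n - h) u u' v,
            ENNReal.ofReal (C * (p ^ (n - h) * potential r B n h v ^ 2)) *
              {ω : Decisions d | u' ∈ remaining ω (n - h)}.indicator 1 ω₂ ∂(law d q) ≤
      ENNReal.ofReal (C * 9 ^ d * ∑ v ∈ desc (n - h) (0 : Fin d → ℕ),
        r ^ (n - h) * potential r B n h v ^ 2) := by
    intro h _
    rw [lintegral_finsetSum _ fun u _ =>
      Finset.measurable_sum _ fun v _ => Finset.measurable_sum _ fun u' _ => hmeas h u' v]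
    have hu : ∀ u ∈ desc (n - h) (0 : Fin d → ℕ), ∫⁻ ω₂,
        ∑ v ∈ desc (n - h) (0 : Fin d → ℕ),
          ∑ u' ∈ (desc (n - h) (0 : Fin d → ℕ)).filter fun u' => SumNear 8 (n - h) u u' v,
            ENNReal.ofReal (C * (p ^ (n - h) * potential r B n h v ^ 2)) *
              {ω : Decisions d | u' ∈ remaining ω (n - h)}.indicator 1 ω₂ ∂(law d q) ≤
        ENNReal.ofReal (∑ v ∈ desc (n - h) (0 : Fin d → ℕ),
          9 ^ d * (C * (p ^ (n - h) * potential r B n h v ^ 2) * q ^ (n - h))) := by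
      intro u _
      rw [lintegral_finsetSum _ fun v _ => Finset.measurable_sum _ fun u' _ => hmeas h u' v,
        ENNReal.ofReal_sum_of_nonneg fun v _ => mul_nonneg (by positivity)
          (mul_nonneg (hnn h v) (pow_nonneg hq.1.le _))]
      refine Finset.sum_le_sum fun v _ => ?_
      rw [lintegral_finsetSum _ fun u' _ => hmeas h u' v]
      have hu' : ∀ u' ∈ (desc (n - h) (0 : Fin d → ℕ)).filter fun u' => SumNear 8 (n - h) u u' v,
          ∫⁻ ω₂, ENNReal.ofReal (C * (p ^ (n - h) * potential r B n h v ^ 2)) *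
              {ω : Decisions d | u' ∈ remaining ω (n - h)}.indicator 1 ω₂ ∂(law d q) =
            ENNReal.ofReal (C * (p ^ (n - h) * potential r B n h v ^ 2) * q ^ (n - h)) := by
        intro u' hu'
        rw [lintegral_const_mul _ (measurable_one.indicator (measurableSet_remaining _ _)),
          lintegral_indicator_one (measurableSet_remaining _ _),
          law_remaining ⟨hq.1.le, hq.2.le⟩ (Finset.mem_filter.1 hu').1,
          ENNReal.ofReal_mul (hnn h v), ENNReal.ofReal_pow hq.1.le]
      rw [Finset.sum_congr rfl hu', Finset.sum_const, nsmul_eq_mul,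
        ENNReal.ofReal_mul (p := 9 ^ d) (by positivity)]
      gcongr
      rw [ENNReal.ofReal_pow (by norm_num)]
      have := card_sumNear_le (n - h) (desc (n - h) (0 : Fin d → ℕ)) u v
      simpa using (Nat.cast_le (α := ℝ≥0∞)).2 this
    refine (Finset.sum_le_sum hu).trans ?_
    rw [Finset.sum_const, card_desc, ← ENNReal.ofReal_nsmul, nsmul_eq_mul]
    refine ENNReal.ofReal_le_ofReal (le_of_eq ?_)
    rw [Finset.mul_sum, Finset.mul_sum]
    refine Finset.sum_congr rfl fun v _ => ?_
    rw [hr]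
    push_cast
    rw [mul_pow, mul_pow, ← pow_mul, ← pow_mul, mul_comm d]
    ring
  refine (Finset.sum_le_sum hlevel).trans ?_
  rw [← ENNReal.ofReal_sum_of_nonneg fun h _ => by positivity, ← Finset.mul_sum,
    energy_potential hr0, law_hit ⟨hr0.le, hr1.le⟩, ← ENNReal.ofReal_mul (by positivity)]
  exact ENNReal.ofReal_le_ofReal (mul_le_mul_of_nonneg_left
    (conductance_le_hitProb hr0 hr1 B n 0) (by positivity))

/-! ### Lower bound for the sum: the second moment method -/

/-- Two cubes of the same generation are neighbours or neighbours of neighbours. -/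
def Near (v w : Fin d → ℕ) : Prop := ∀ i, |(v i : ℤ) - w i| ≤ 2

lemma Near.symm {v w : Fin d → ℕ} (h : Near v w) : Near w v := fun i => by
  rw [abs_sub_comm]; exact h i

lemma card_near_le (s : Finset (Fin d → ℕ)) (v : Fin d → ℕ) [DecidablePred (Near v)] :
    (s.filter (Near v)).card ≤ 5 ^ d := by
  refine card_filter_le s _ (fun i => (v i : ℤ) - 2) 4 fun u h i => ?_
  have := abs_le.1 (h i)
  constructor <;> push_cast <;> omega

lemma sum_near_sq_le (s : Finset (Fin d → ℕ)) (m : (Fin d → ℕ) → ℝ)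
    [∀ v : Fin d → ℕ, DecidablePred (Near v)] :
    ∑ v ∈ s, ∑ w ∈ s.filter (Near v), m w ^ 2 ≤ 5 ^ d * ∑ v ∈ s, m v ^ 2 := by
  simp_rw [Finset.sum_filter]
  rw [Finset.sum_comm, Finset.mul_sum]
  refine Finset.sum_le_sum fun w _ => ?_
  rw [← Finset.sum_filter, Finset.sum_const, nsmul_eq_mul]
  refine mul_le_mul_of_nonneg_right ?_ (sq_nonneg _)
  have : (s.filter fun v => Near v w) = s.filter (Near w) :=
    Finset.filter_congr fun v _ => ⟨Near.symm, Near.symm⟩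
  rw [this]
  exact_mod_cast card_near_le s w

/-- Each product is at most half the sum of the two squares, and in this symmetric relation every
cube has at most 5^d partners. -/
lemma sum_mul_near_le (s : Finset (Fin d → ℕ)) (m : (Fin d → ℕ) → ℝ)
    [∀ v : Fin d → ℕ, DecidablePred (Near v)] :
    ∑ v ∈ s, ∑ w ∈ s.filter (Near v), m v * m w ≤ 5 ^ d * ∑ v ∈ s, m v ^ 2 := by
  have h1 : ∑ v ∈ s, ∑ w ∈ s.filter (Near v), m v * m w ≤
      ∑ v ∈ s, ∑ w ∈ s.filter (Near v), (m v ^ 2 / 2 + m w ^ 2 / 2) :=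
    Finset.sum_le_sum fun v _ => Finset.sum_le_sum fun w _ => by nlinarith [sq_nonneg (m v - m w)]
  refine h1.trans ?_
  simp_rw [Finset.sum_add_distrib, ← Finset.sum_div]
  have h2 := sum_near_sq_le s m
  have h3 : ∑ v ∈ s, ∑ w ∈ s.filter (Near v), m v ^ 2 ≤ 5 ^ d * ∑ v ∈ s, m v ^ 2 := by
    rw [Finset.mul_sum]
    refine Finset.sum_le_sum fun v _ => ?_
    rw [Finset.sum_const, nsmul_eq_mul]
    refine mul_le_mul_of_nonneg_right ?_ (sq_nonneg _)
    exact_mod_cast card_near_le s v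
  linarith

/-- The second moment method. -/
lemma second_moment {Ω ι : Type*} [MeasurableSpace Ω] (P : Measure Ω) [IsProbabilityMeasure P]
    (T : Finset ι) (w : ι → ℝ) (E : ι → Set Ω) (hE : ∀ x, MeasurableSet (E x))
    (F : Set Ω) (hF : MeasurableSet F) (hEF : ∀ x ∈ T, w x ≠ 0 → E x ⊆ F) (t : ℝ) :
    2 * t * ∑ x ∈ T, w x * P.real (E x) -
      t ^ 2 * ∑ x ∈ T, ∑ y ∈ T, w x * w y * P.real (E x ∩ E y) ≤ P.real F := by
  set X : Ω → ℝ := fun ω => ∑ x ∈ T, w x * (E x).indicator 1 ω with hX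
  have hi : ∀ A : Set Ω, MeasurableSet A → Integrable (A.indicator (1 : Ω → ℝ)) P := fun A hA =>
    (integrable_const (1 : ℝ)).indicator hA
  have hI : ∀ A : Set Ω, MeasurableSet A → ∫ ω, A.indicator (1 : Ω → ℝ) ω ∂P = P.real A :=
    fun A hA => integral_indicator_one hA
  have hX2 : ∀ ω, X ω ^ 2 = ∑ x ∈ T, ∑ y ∈ T, w x * w y * (E x ∩ E y).indicator 1 ω := by
    intro ω
    rw [hX, sq, Finset.sum_mul_sum]
    refine Finset.sum_congr rfl fun x _ => Finset.sum_congr rfl fun y _ => ?_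
    rw [Set.inter_indicator_one]
    simp only [Pi.mul_apply]
    ring
  have i1 : Integrable X P := integrable_finsetSum _ fun x _ => (hi _ (hE x)).const_mul _
  have i2 : Integrable (fun ω => X ω ^ 2) P := by
    simp_rw [hX2]
    exact integrable_finsetSum _ fun x _ => integrable_finsetSum _ fun y _ =>
      (hi _ ((hE x).inter (hE y))).const_mul _
  have e1 : ∫ ω, X ω ∂P = ∑ x ∈ T, w x * P.real (E x) := by
    rw [hX, integral_finsetSum _ fun x _ => (hi _ (hE x)).const_mul _]
    refine Finset.sum_congr rfl fun x _ => ?_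
    rw [integral_const_mul, hI _ (hE x)]
  have e2 : ∫ ω, X ω ^ 2 ∂P = ∑ x ∈ T, ∑ y ∈ T, w x * w y * P.real (E x ∩ E y) := by
    simp_rw [hX2]
    rw [integral_finsetSum _ fun x _ => integrable_finsetSum _ fun y _ =>
      (hi _ ((hE x).inter (hE y))).const_mul _]
    refine Finset.sum_congr rfl fun x _ => ?_
    rw [integral_finsetSum _ fun y _ => (hi _ ((hE x).inter (hE y))).const_mul _]
    refine Finset.sum_congr rfl fun y _ => ?_
    rw [integral_const_mul, hI _ ((hE x).inter (hE y))]
  rw [← e1, ← e2, ← hI F hF, ← integral_const_mul, ← integral_const_mul,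
    ← integral_sub (i1.const_mul _) (i2.const_mul _)]
  refine integral_mono ((i1.const_mul _).sub (i2.const_mul _)) (hi F hF) fun ω => ?_
  -- Pointwise, 2tX - t²X² ≤ 1 on F, while X = 0 off F.
  by_cases hω : ω ∈ F
  · simp only [hω, Set.indicator_of_mem, Pi.one_apply]
    nlinarith [sq_nonneg (1 - t * X ω)]
  · have : X ω = 0 := by
      refine Finset.sum_eq_zero fun x hx => ?_
      by_cases hw : w x = 0
      · simp [hw]
      · simp [Set.indicator_of_notMem fun h => hω (hEF x hx hw h)]
    simp [this, hω]

/-- The pairs of cubes of generation `n` whose sum is the cube `a` (after centering). -/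
def sumPairs (n : ℕ) (a : Fin d → ℕ) : Finset ((Fin d → ℕ) × (Fin d → ℕ)) :=
  (desc n 0 ×ˢ desc n 0).filter fun c => ∀ i, c.1 i + c.2 i = a i + 2 ^ (n - 1)

lemma mem_box {n : ℕ} {c : Fin d → ℕ} : c ∈ desc n (0 : Fin d → ℕ) ↔ ∀ i, c i < 2 ^ n := by
  rw [mem_desc, funext_iff]
  refine forall_congr' fun i => ?_
  simp [anc, Nat.div_eq_zero_iff]

lemma mem_sumPairs {n : ℕ} {a : Fin d → ℕ} {c : (Fin d → ℕ) × (Fin d → ℕ)} :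
    c ∈ sumPairs n a ↔ (c.1 ∈ desc n (0 : Fin d → ℕ) ∧ c.2 ∈ desc n (0 : Fin d → ℕ)) ∧
      ∀ i, c.1 i + c.2 i = a i + 2 ^ (n - 1) := by
  rw [sumPairs, Finset.mem_filter, Finset.mem_product]

/-- With N = 2^(n-1), each coordinate of c may be any number in [0, N) if a < N and in [N, 2N)
otherwise; the second summand a + N - c then stays in the box. -/
lemma le_card_sumPairs {n : ℕ} (hn : 1 ≤ n) {a : Fin d → ℕ} (ha : a ∈ desc n (0 : Fin d → ℕ)) :
    (2 ^ (n - 1)) ^ d ≤ (sumPairs n a).card := by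
  rw [mem_box] at ha
  have h2 : 2 ^ n = 2 * 2 ^ (n - 1) := by rw [← pow_succ']; congr 1; omega
  set N := 2 ^ (n - 1)
  set lo : Fin d → ℕ := fun i => if a i < N then 0 else N with hlo
  have : (Fintype.piFinset fun i => Finset.Ico (lo i) (lo i + N)).card = N ^ d := by
    simp [Fintype.card_piFinset]
  rw [← this]
  refine Finset.card_le_card_of_injOn (fun c => (c, fun i => a i + N - c i)) ?_ ?_
  · intro c hc
    rw [Finset.mem_coe, Fintype.mem_piFinset] at hc
    simp only [Finset.mem_Ico] at hc
    rw [Finset.mem_coe, mem_sumPairs, mem_box, mem_box]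
    refine ⟨⟨fun i => ?_, fun i => ?_⟩, fun i => ?_⟩ <;>
    · have h1 := hc i
      have h3 := ha i
      simp only [hlo] at h1 ⊢
      split_ifs at h1 <;> omega
  · intro c _ c' _ h
    exact (Prod.ext_iff.1 h).1

/-- For fixed targets a and b, either component of a pair determines the other. It therefore
suffices to count the components in the factor with the deeper common ancestor. -/
lemma card_pairs_le (n j j' : ℕ) (a b : Fin d → ℕ) :
    ((sumPairs n a ×ˢ sumPairs n b).filter fun x => anc (n - j) x.1.1 = anc (n - j) x.2.1 ∧
      anc (n - j') x.1.2 = anc (n - j') x.2.2).card ≤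
      (2 ^ n) ^ d * (2 ^ (n - max j j')) ^ d := by
  have key : ∀ l : ℕ, ((desc n (0 : Fin d → ℕ)).sigma fun c => desc (n - l) (anc (n - l) c)).card =
      (2 ^ n) ^ d * (2 ^ (n - l)) ^ d := by
    intro l
    simp [Finset.card_sigma, card_desc]
  rcases le_total j j' with h | h
  · rw [max_eq_right h, ← key]
    refine Finset.card_le_card_of_injOn (fun x => ⟨x.1.2, x.2.2⟩) ?_ ?_
    · intro x hx
      simp only [Finset.coe_filter, Finset.mem_product, mem_sumPairs, Set.mem_ofPred_eq] at hx
      simp only [Finset.mem_coe, Finset.mem_sigma]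
      exact ⟨hx.1.1.1.2, mem_desc.2 hx.2.2.symm⟩
    · intro x hx y hy hxy
      simp only [Finset.coe_filter, Finset.mem_product, mem_sumPairs, Set.mem_ofPred_eq] at hx hy
      simp only [Sigma.mk.injEq, heq_eq_eq] at hxy
      refine Prod.ext (Prod.ext (funext fun i => ?_) hxy.1) (Prod.ext (funext fun i => ?_) hxy.2)
      · have h1 := hx.1.1.2 i; have h2 := hy.1.1.2 i; rw [hxy.1] at h1; omega
      · have h1 := hx.1.2.2 i; have h2 := hy.1.2.2 i; rw [hxy.2] at h1; omega
  · rw [max_eq_left h, ← key]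
    refine Finset.card_le_card_of_injOn (fun x => ⟨x.1.1, x.2.1⟩) ?_ ?_
    · intro x hx
      simp only [Finset.coe_filter, Finset.mem_product, mem_sumPairs, Set.mem_ofPred_eq] at hx
      simp only [Finset.mem_coe, Finset.mem_sigma]
      exact ⟨hx.1.1.1.1, mem_desc.2 hx.2.1.symm⟩
    · intro x hx y hy hxy
      simp only [Finset.coe_filter, Finset.mem_product, mem_sumPairs, Set.mem_ofPred_eq] at hx hy
      simp only [Sigma.mk.injEq, heq_eq_eq] at hxy
      refine Prod.ext (Prod.ext hxy.1 (funext fun i => ?_)) (Prod.ext hxy.2 (funext fun i => ?_))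
      · have h1 := hx.1.1.2 i; have h2 := hy.1.1.2 i; rw [hxy.1] at h1; omega
      · have h1 := hx.1.2.2 i; have h2 := hy.1.2.2 i; rw [hxy.2] at h1; omega

lemma anc_eq_of_le {h k : ℕ} (hk : h ≤ k) {b c : Fin d → ℕ} (e : anc h b = anc h c) :
    anc k b = anc k c := by
  rw [← Nat.add_sub_cancel' hk, ← anc_anc, e, anc_anc]

/-- Each summand differs between the two pairs by less than T = 2^h, so the targets differ by less
than 2T and their ancestors by at most 2. -/
lemma near_of_pairs {n h : ℕ} {a b : Fin d → ℕ} {c e : (Fin d → ℕ) × (Fin d → ℕ)}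
    (hc : c ∈ sumPairs n a) (he : e ∈ sumPairs n b) (h1 : anc h c.1 = anc h e.1)
    (h2 : anc h c.2 = anc h e.2) : Near (anc h a) (anc h b) := by
  intro i
  rw [mem_sumPairs] at hc he
  have s1 := hc.2 i
  have s2 := he.2 i
  have d1 : c.1 i / 2 ^ h = e.1 i / 2 ^ h := congrFun h1 i
  have d2 : c.2 i / 2 ^ h = e.2 i / 2 ^ h := congrFun h2 i
  have q1 := Nat.div_add_mod (c.1 i) (2 ^ h)
  have q2 := Nat.div_add_mod (c.2 i) (2 ^ h)
  have q3 := Nat.div_add_mod (e.1 i) (2 ^ h)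
  have q4 := Nat.div_add_mod (e.2 i) (2 ^ h)
  have q5 := Nat.div_add_mod (a i) (2 ^ h)
  have q6 := Nat.div_add_mod (b i) (2 ^ h)
  have hT : 0 < 2 ^ h := by positivity
  have l1 := Nat.mod_lt (c.1 i) hT
  have l2 := Nat.mod_lt (c.2 i) hT
  have l3 := Nat.mod_lt (e.1 i) hT
  have l4 := Nat.mod_lt (e.2 i) hT
  have l5 := Nat.mod_lt (a i) hT
  have l6 := Nat.mod_lt (b i) hT
  rw [d1] at q1
  rw [d2] at q2
  simp only [anc]
  generalize 2 ^ h = T at *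
  have u1 : a i < b i + 2 * T := by omega
  have u2 : b i < a i + 2 * T := by omega
  generalize a i / T = x at *
  generalize b i / T = y at *
  have v1 : x < y + 3 := by
    by_contra! hlt
    have := Nat.mul_le_mul_left T hlt
    rw [mul_add] at this
    omega
  have v2 : y < x + 3 := by
    by_contra! hlt
    have := Nat.mul_le_mul_left T hlt
    rw [mul_add] at this
    omega
  rw [abs_le]
  omega

/-- The weighted number of quadruples contributing to the second moment at two given levels. -/
lemma sum_pairs_le {n j j' : ℕ} (μ : (Fin d → ℕ) → ℝ) (hμ : ∀ a, 0 ≤ μ a) (hj : j ≤ n) :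
    ∑ a ∈ desc n (0 : Fin d → ℕ), ∑ b ∈ desc n (0 : Fin d → ℕ), μ a * μ b *
      ((sumPairs n a ×ˢ sumPairs n b).filter fun x => anc (n - j) x.1.1 = anc (n - j) x.2.1 ∧
      anc (n - j') x.1.2 = anc (n - j') x.2.2).card ≤
    (2 ^ n) ^ d * (2 ^ (n - max j j')) ^ d * (5 ^ d *
      ∑ v ∈ desc (min j j') (0 : Fin d → ℕ), (∑ a ∈ desc (n - min j j') v, μ a) ^ 2) := by
  classical
  set k := min j j' with hk
  have hkn : k ≤ n := (min_le_left _ _).trans hj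
  have hle : ∀ a ∈ desc n (0 : Fin d → ℕ), ∀ b ∈ desc n (0 : Fin d → ℕ), μ a * μ b *
      (((sumPairs n a ×ˢ sumPairs n b).filter fun x => anc (n - j) x.1.1 = anc (n - j) x.2.1 ∧
      anc (n - j') x.1.2 = anc (n - j') x.2.2).card : ℝ) ≤
      (2 ^ n) ^ d * (2 ^ (n - max j j')) ^ d *
        if Near (anc (n - k) a) (anc (n - k) b) then μ a * μ b else 0 := by
    intro a _ b _
    have hab := mul_nonneg (hμ a) (hμ b)
    split_ifs with hnear
    · rw [mul_comm]
      refine mul_le_mul_of_nonneg_right ?_ hab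
      exact_mod_cast card_pairs_le n j j' a b
    · rw [mul_zero, Finset.filter_false_of_mem, Finset.card_empty]
      · simp
      · intro x hx h
        rw [Finset.mem_product] at hx
        exact hnear (near_of_pairs hx.1 hx.2
          (anc_eq_of_le (by have := min_le_left j j'; omega) h.1)
          (anc_eq_of_le (by have := min_le_right j j'; omega) h.2))
  refine (Finset.sum_le_sum fun a ha => Finset.sum_le_sum fun b hb => hle a ha b hb).trans ?_
  simp_rw [← Finset.mul_sum]
  refine mul_le_mul_of_nonneg_left ?_ (by positivity)
  have hn : n = (n - k) + k := by omega
  refine le_trans (le_of_eq ?_) (sum_mul_near_le (desc k (0 : Fin d → ℕ))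
    fun v => ∑ a ∈ desc (n - k) v, μ a)
  have : ∀ f : (Fin d → ℕ) → ℝ, ∑ a ∈ desc n (0 : Fin d → ℕ), f a =
      ∑ v ∈ desc k (0 : Fin d → ℕ), ∑ a ∈ desc (n - k) v, f a := fun f => by
    conv_lhs => rw [hn]
    exact sum_desc_add _ _ _ _
  simp_rw [this]
  refine Finset.sum_congr rfl fun v _ => ?_
  rw [Finset.sum_comm, Finset.sum_filter]
  refine Finset.sum_congr rfl fun w _ => ?_
  split_ifs with hvw
  · rw [Finset.sum_mul_sum]
    refine Finset.sum_congr rfl fun a ha => Finset.sum_congr rfl fun b hb => ?_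
    rw [mem_desc] at ha hb
    rw [ha, hb, if_pos hvw]
  · refine Finset.sum_eq_zero fun a ha => Finset.sum_eq_zero fun b hb => ?_
    rw [mem_desc] at ha hb
    rw [ha, hb, if_neg hvw]

lemma sum_geometric_shift_le {α : ℝ} (h0 : 0 ≤ α) (h1 : α < 1) (k N : ℕ) :
    ∑ j ∈ Finset.range N, (if k ≤ j then α ^ (j - k) else 0) ≤ (1 - α)⁻¹ := by
  rw [← Finset.sum_filter]
  have : (Finset.range N).filter (k ≤ ·) = Finset.Ico k N := by
    ext j; simp [and_comm]
  rw [this, Finset.sum_Ico_eq_sum_range, ← tsum_geometric_of_lt_one h0 h1]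
  simp only [Nat.add_sub_cancel_left]
  exact (summable_geometric_of_lt_one h0 h1).sum_le_tsum _ fun i _ => pow_nonneg h0 i

/-- If j' ≤ j, the weight factors as r^(-j') (Dp)^(-(j-j')), and symmetrically with q when j ≤ j'.
The conditions Dp, Dq > 1 make the sum over the gap a convergent geometric series. -/
lemma sum_levels_le {D p q r : ℝ} (hD : 0 < D) (hp : 0 < p) (hq : 0 < q) (hp' : 1 < D * p)
    (hq' : 1 < D * q) (hr : r = D * p * q) (N : ℕ) (M : ℕ → ℝ) (hM : ∀ k, 0 ≤ M k) :
    ∑ j ∈ Finset.range N, ∑ j' ∈ Finset.range N,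
      (p ^ j)⁻¹ * (q ^ j')⁻¹ * ((D ^ max j j')⁻¹ * M (min j j')) ≤
    ((1 - (D * p)⁻¹)⁻¹ + (1 - (D * q)⁻¹)⁻¹) * ∑ k ∈ Finset.range N, (r ^ k)⁻¹ * M k := by
  have ha0 : 0 ≤ (D * p)⁻¹ := by positivity
  have hb0 : 0 ≤ (D * q)⁻¹ := by positivity
  have ha1 : (D * p)⁻¹ < 1 := inv_lt_one_of_one_lt₀ hp'
  have hb1 : (D * q)⁻¹ < 1 := inv_lt_one_of_one_lt₀ hq'
  have hr0 : 0 < r := by rw [hr]; positivity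
  have hterm : ∀ j j' : ℕ, (p ^ j)⁻¹ * (q ^ j')⁻¹ * ((D ^ max j j')⁻¹ * M (min j j')) ≤
      (r ^ j')⁻¹ * M j' * (if j' ≤ j then (D * p)⁻¹ ^ (j - j') else 0) +
      (r ^ j)⁻¹ * M j * (if j ≤ j' then (D * q)⁻¹ ^ (j' - j) else 0) := by
    intro j j'
    rcases le_total j' j with h | h
    · rw [max_eq_left h, min_eq_right h, if_pos h]
      refine le_trans (le_of_eq ?_) (le_add_of_nonneg_right ?_)
      · obtain ⟨i, rfl⟩ := Nat.exists_eq_add_of_le h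
        rw [hr, Nat.add_sub_cancel_left, inv_pow]
        field_simp
        ring
      · have := hM j
        positivity
    · rw [max_eq_right h, min_eq_left h, if_pos h]
      refine le_trans (le_of_eq ?_) (le_add_of_nonneg_left ?_)
      · obtain ⟨i, rfl⟩ := Nat.exists_eq_add_of_le h
        rw [hr, Nat.add_sub_cancel_left, inv_pow]
        field_simp
        ring
      · have := hM j'
        positivity
  refine (Finset.sum_le_sum fun j _ => Finset.sum_le_sum fun j' _ => hterm j j').trans ?_
  simp_rw [Finset.sum_add_distrib]
  rw [add_mul]
  refine add_le_add ?_ ?_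
  · rw [Finset.sum_comm, Finset.mul_sum]
    refine Finset.sum_le_sum fun k _ => ?_
    rw [← Finset.mul_sum, mul_comm]
    have := hM k
    exact mul_le_mul_of_nonneg_right (sum_geometric_shift_le ha0 ha1 k N) (by positivity)
  · rw [Finset.mul_sum]
    refine Finset.sum_le_sum fun k _ => ?_
    rw [← Finset.mul_sum, mul_comm]
    have := hM k
    exact mul_le_mul_of_nonneg_right (sum_geometric_shift_le hb0 hb1 k N) (by positivity)

/-- Replacing the exact branching level by a sum over all levels with a common ancestor only adds
nonnegative terms, and the resulting sums for the two percolations multiply out. -/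
lemma law_remaining_pair_le {p : ℝ} (hp : p ∈ Set.Ioo (0 : ℝ) 1) {n : ℕ} {c e : Fin d → ℕ}
    (hc : c ∈ desc n (0 : Fin d → ℕ)) (he : e ∈ desc n (0 : Fin d → ℕ)) :
    (law d p).real {ω | c ∈ remaining ω n ∧ e ∈ remaining ω n} ≤
      p ^ (2 * n) * ∑ j ∈ Finset.range (n + 1),
        (p ^ j)⁻¹ * (if anc (n - j) c = anc (n - j) e then 1 else 0) := by
  obtain ⟨j, hj, h1, h2⟩ := law_remaining_pair hp hc he
  have := hp.1
  rw [h2]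
  refine mul_le_mul_of_nonneg_left ?_ (by positivity)
  refine le_trans (by simp [h1]) (Finset.single_le_sum (f := fun j => (p ^ j)⁻¹ *
    (if anc (n - j) c = anc (n - j) e then (1 : ℝ) else 0)) (fun i _ => by positivity)
    (Finset.mem_range.2 (Nat.lt_succ_of_le hj)))

/-- The set of pairs of decisions for which the sum of the percolations of generation `n` hits `B`. -/
def sumHit (n : ℕ) (B : Set (Fin d → ℕ)) : Set (Decisions d × Decisions d) :=
  {ω | ∃ c ∈ remaining ω.1 n, ∃ c' ∈ remaining ω.2 n, ∃ a ∈ B,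
    ∀ i, c i + c' i = a i + 2 ^ (n - 1)}

theorem conductance_le_law_sumHit {p q r : ℝ} (hp : p ∈ Set.Ioo (0 : ℝ) 1)
    (hq : q ∈ Set.Ioo (0 : ℝ) 1) (hr : r = 2 ^ d * p * q) (hp' : 1 < 2 ^ d * p)
    (hq' : 1 < 2 ^ d * q) {n : ℕ} (hn : 1 ≤ n) (B : Set (Fin d → ℕ)) :
    (4 ^ d * 5 ^ d * ((1 - (2 ^ d * p)⁻¹)⁻¹ + (1 - (2 ^ d * q)⁻¹)⁻¹))⁻¹ * conductance r B n 0 ≤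
      ((law d p).prod (law d q)).real (sumHit n B) := by
  classical
  have hp0 := hp.1
  have hq0 := hq.1
  have hr0 : 0 < r := by rw [hr]; positivity
  have ha1 : (2 ^ d * p)⁻¹ < 1 := inv_lt_one_of_one_lt₀ hp'
  have hb1 : (2 ^ d * q)⁻¹ < 1 := inv_lt_one_of_one_lt₀ hq'
  set G := (1 - (2 ^ d * p)⁻¹)⁻¹ + (1 - (2 ^ d * q)⁻¹)⁻¹ with hG
  have hG0 : 0 < G := add_pos (inv_pos.2 (by linarith)) (inv_pos.2 (by linarith))
  set μ : (Fin d → ℕ) → ℝ := fun b => r ^ n * potential r B n 0 b with hμ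
  have hμ0 : ∀ b, 0 ≤ μ b := fun b => mul_nonneg (by positivity) (potential_nonneg hr0 B n 0 b)
  set T := (desc n (0 : Fin d → ℕ)).sigma fun a => sumPairs n a with hT
  set E : (_ : Fin d → ℕ) × ((Fin d → ℕ) × (Fin d → ℕ)) → Set (Decisions d × Decisions d) :=
    fun x => {ω | x.2.1 ∈ remaining ω n} ×ˢ {ω | x.2.2 ∈ remaining ω n} with hE
  have hEm : ∀ x, MeasurableSet (E x) := fun x =>
    (measurableSet_remaining n _).prod (measurableSet_remaining n _)
  have hFm : MeasurableSet (sumHit n B) := measurableSet_sum_hit n fun c c' =>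
    ∃ a ∈ B, ∀ i, c i + c' i = a i + 2 ^ (n - 1)
  have hEF : ∀ x ∈ T, μ x.1 ≠ 0 → E x ⊆ sumHit n B := by
    rintro x hx hx0 ω ⟨h1, h2⟩
    have hxB : x.1 ∈ B := by
      by_contra hB
      exact hx0 (by simp only [hμ, potential_zero_of_notMem B n hB, mul_zero])
    rw [hT, Finset.mem_sigma, mem_sumPairs] at hx
    exact ⟨_, h1, _, h2, _, hxB, hx.2.2⟩
  set K := conductance r B n 0 with hK
  have hK0 : 0 ≤ K := (conductance_mem hr0 B n 0).1
  set D : ℝ := p ^ n * q ^ n * (2 ^ n) ^ d with hD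
  have hD0 : 0 < D := by positivity
  -- the first moment
  have first : ((2 : ℝ) ^ d)⁻¹ * D * K ≤
      ∑ x ∈ T, μ x.1 * ((law d p).prod (law d q)).real (E x) := by
    have : ∀ x ∈ T, μ x.1 * ((law d p).prod (law d q)).real (E x) =
        μ x.1 * (p ^ n * q ^ n) := by
      intro x hx
      rw [hT, Finset.mem_sigma, mem_sumPairs] at hx
      rw [hE, measureReal_prod_prod, Measure.real, Measure.real,
        law_remaining ⟨hp0.le, hp.2.le⟩ hx.2.1.1, law_remaining ⟨hq0.le, hq.2.le⟩ hx.2.1.2]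
      simp [ENNReal.toReal_ofReal, hp0.le, hq0.le]
    rw [Finset.sum_congr rfl this, hT, Finset.sum_sigma, hK, ← sum_flow hr0 B n 0, Finset.mul_sum]
    refine Finset.sum_le_sum fun a ha => ?_
    simp only [Finset.sum_const, nsmul_eq_mul]
    have h1 : (((2 : ℝ) ^ (n - 1)) ^ d) ≤ (sumPairs n a).card := by
      exact_mod_cast le_card_sumPairs hn ha
    have h2 : ((2 : ℝ) ^ n) ^ d = 2 ^ d * (2 ^ (n - 1)) ^ d := by
      rw [← mul_pow, ← pow_succ']; congr 2; omega
    have h3 : ((2 : ℝ) ^ d)⁻¹ * D * μ a = (2 ^ (n - 1)) ^ d * (μ a * (p ^ n * q ^ n)) := by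
      rw [hD, h2]; field_simp
    change ((2 : ℝ) ^ d)⁻¹ * D * μ a ≤ _
    rw [h3]
    exact mul_le_mul_of_nonneg_right h1 (mul_nonneg (hμ0 a) (by positivity))
  -- the second moment
  have second : ∑ x ∈ T, ∑ y ∈ T, μ x.1 * μ y.1 * ((law d p).prod (law d q)).real (E x ∩ E y) ≤
      D ^ 2 * (5 ^ d * G) * K := by
    have hpair : ∀ x ∈ T, ∀ y ∈ T, μ x.1 * μ y.1 * ((law d p).prod (law d q)).real (E x ∩ E y) ≤
        ∑ j ∈ Finset.range (n + 1), ∑ j' ∈ Finset.range (n + 1), p ^ (2 * n) * q ^ (2 * n) *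
          ((p ^ j)⁻¹ * (q ^ j')⁻¹ * (μ x.1 * μ y.1 * if anc (n - j) x.2.1 = anc (n - j) y.2.1 ∧
            anc (n - j') x.2.2 = anc (n - j') y.2.2 then 1 else 0)) := by
      intro x hx y hy
      rw [hT, Finset.mem_sigma, mem_sumPairs] at hx hy
      rw [hE, Set.prod_inter_prod, measureReal_prod_prod]
      have h1 := law_remaining_pair_le hp hx.2.1.1 hy.2.1.1
      have h2 := law_remaining_pair_le hq hx.2.1.2 hy.2.1.2
      refine (mul_le_mul_of_nonneg_left (mul_le_mul h1 h2 measureReal_nonneg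
        (measureReal_nonneg.trans h1)) (mul_nonneg (hμ0 _) (hμ0 _))).trans (le_of_eq ?_)
      rw [mul_mul_mul_comm (p ^ (2 * n)), Finset.sum_mul_sum]
      simp_rw [Finset.mul_sum]
      refine Finset.sum_congr rfl fun j _ => Finset.sum_congr rfl fun j' _ => ?_
      simp only [ite_and]
      split_ifs <;> ring
    refine (Finset.sum_le_sum fun x hx => Finset.sum_le_sum fun y hy => hpair x hx y hy).trans ?_
    have hswap : ∑ x ∈ T, ∑ y ∈ T, ∑ j ∈ Finset.range (n + 1), ∑ j' ∈ Finset.range (n + 1),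
        p ^ (2 * n) * q ^ (2 * n) *
          ((p ^ j)⁻¹ * (q ^ j')⁻¹ * (μ x.1 * μ y.1 * if anc (n - j) x.2.1 = anc (n - j) y.2.1 ∧
            anc (n - j') x.2.2 = anc (n - j') y.2.2 then 1 else 0)) =
        p ^ (2 * n) * q ^ (2 * n) * ∑ j ∈ Finset.range (n + 1), ∑ j' ∈ Finset.range (n + 1),
          (p ^ j)⁻¹ * (q ^ j')⁻¹ * ∑ a ∈ desc n (0 : Fin d → ℕ), ∑ b ∈ desc n (0 : Fin d → ℕ),
            μ a * μ b * ((sumPairs n a ×ˢ sumPairs n b).filter fun x =>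
              anc (n - j) x.1.1 = anc (n - j) x.2.1 ∧
              anc (n - j') x.1.2 = anc (n - j') x.2.2).card := by
      have : ∀ x ∈ T, ∑ y ∈ T, ∑ j ∈ Finset.range (n + 1), ∑ j' ∈ Finset.range (n + 1),
          p ^ (2 * n) * q ^ (2 * n) *
          ((p ^ j)⁻¹ * (q ^ j')⁻¹ * (μ x.1 * μ y.1 * if anc (n - j) x.2.1 = anc (n - j) y.2.1 ∧
            anc (n - j') x.2.2 = anc (n - j') y.2.2 then 1 else 0)) =
          ∑ j ∈ Finset.range (n + 1), ∑ j' ∈ Finset.range (n + 1), ∑ y ∈ T,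
          p ^ (2 * n) * q ^ (2 * n) *
          ((p ^ j)⁻¹ * (q ^ j')⁻¹ * (μ x.1 * μ y.1 * if anc (n - j) x.2.1 = anc (n - j) y.2.1 ∧
            anc (n - j') x.2.2 = anc (n - j') y.2.2 then 1 else 0)) := fun x _ => by
        rw [Finset.sum_comm]
        exact Finset.sum_congr rfl fun j _ => Finset.sum_comm
      rw [Finset.sum_congr rfl this, Finset.sum_comm, Finset.mul_sum]
      refine Finset.sum_congr rfl fun j _ => ?_
      rw [Finset.sum_comm, Finset.mul_sum]
      refine Finset.sum_congr rfl fun j' _ => ?_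
      simp_rw [← Finset.mul_sum]
      congr 2
      rw [hT, Finset.sum_sigma]
      refine Finset.sum_congr rfl fun a _ => ?_
      simp_rw [Finset.sum_sigma]
      rw [Finset.sum_comm]
      refine Finset.sum_congr rfl fun b _ => ?_
      rw [Finset.card_filter, Finset.sum_product]
      push_cast
      simp_rw [Finset.mul_sum]
    rw [hswap]
    set M : ℕ → ℝ := fun k => ∑ v ∈ desc k (0 : Fin d → ℕ), (∑ a ∈ desc (n - k) v, μ a) ^ 2 with hM
    have hM0 : ∀ k, 0 ≤ M k := fun k => Finset.sum_nonneg fun v _ => sq_nonneg _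
    -- The weights μ form the r-equilibrium flow, whose mass and energy are both the conductance K.
    have hMK : ∑ k ∈ Finset.range (n + 1), (r ^ k)⁻¹ * M k = K := by
      rw [hK, ← energy_potential hr0 B n 0, ← Finset.sum_range_reflect]
      refine Finset.sum_congr rfl fun h hh => ?_
      rw [Finset.mem_range] at hh
      simp only [hM]
      rw [show n + 1 - 1 - h = n - h by omega, Finset.mul_sum]
      refine Finset.sum_congr rfl fun v _ => ?_
      rw [show n - (n - h) = h by omega, hμ, sum_leaves_potential hr0 B n (by omega)]
      field_simp
    have hbd : ∑ j ∈ Finset.range (n + 1), ∑ j' ∈ Finset.range (n + 1),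
          (p ^ j)⁻¹ * (q ^ j')⁻¹ * ∑ a ∈ desc n (0 : Fin d → ℕ), ∑ b ∈ desc n (0 : Fin d → ℕ),
            μ a * μ b * ((sumPairs n a ×ˢ sumPairs n b).filter fun x =>
              anc (n - j) x.1.1 = anc (n - j) x.2.1 ∧
              anc (n - j') x.1.2 = anc (n - j') x.2.2).card ≤
        ∑ j ∈ Finset.range (n + 1), ∑ j' ∈ Finset.range (n + 1), ((2 ^ n) ^ d) ^ 2 * 5 ^ d *
          ((p ^ j)⁻¹ * (q ^ j')⁻¹ * ((((2 : ℝ) ^ d) ^ max j j')⁻¹ * M (min j j'))) := by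
      refine Finset.sum_le_sum fun j hj => Finset.sum_le_sum fun j' hj' => ?_
      rw [Finset.mem_range] at hj hj'
      refine (mul_le_mul_of_nonneg_left (sum_pairs_le (j' := j') μ hμ0 (show j ≤ n by omega))
        (by positivity)).trans (le_of_eq ?_)
      have hmax : max j j' ≤ n := by omega
      have : ((2 : ℝ) ^ (n - max j j')) ^ d = (2 ^ n) ^ d * ((2 ^ d) ^ max j j')⁻¹ := by
        rw [eq_mul_inv_iff_mul_eq₀ (by positivity), ← pow_mul, ← pow_mul, ← pow_mul, ← pow_add,
          mul_comm d, ← add_mul, Nat.sub_add_cancel hmax]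
      rw [this]
      ring
    have hlev := sum_levels_le (D := 2 ^ d) (by positivity) hp0 hq0 hp' hq' hr (n + 1) M hM0
    rw [hMK] at hlev
    simp_rw [← Finset.mul_sum] at hbd
    calc _ ≤ p ^ (2 * n) * q ^ (2 * n) * (((2 ^ n) ^ d) ^ 2 * 5 ^ d * (G * K)) := by
          refine mul_le_mul_of_nonneg_left (hbd.trans ?_) (by positivity)
          simp_rw [Finset.mul_sum] at hlev ⊢
          simp_rw [← Finset.mul_sum] at hlev ⊢
          exact mul_le_mul_of_nonneg_left hlev (by positivity)
      _ = _ := by rw [hD]; ring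
  have hsm := second_moment ((law d p).prod (law d q)) T (fun x => μ x.1) E hEm (sumHit n B) hFm hEF
    (((2 : ℝ) ^ d)⁻¹ / (5 ^ d * G * D))
  -- The optimal t is the ratio of the bounds on the first and second moments. The factor K cancels,
  -- so K = 0 needs no separate treatment.
  set t := ((2 : ℝ) ^ d)⁻¹ / (5 ^ d * G * D) with ht
  have ht0 : 0 < t := by positivity
  have l1 := mul_le_mul_of_nonneg_left first (show 0 ≤ 2 * t by positivity)
  have l2 := mul_le_mul_of_nonneg_left second (show 0 ≤ t ^ 2 by positivity)
  have : (4 ^ d * 5 ^ d * G)⁻¹ * K = 2 * t * (((2 : ℝ) ^ d)⁻¹ * D * K) -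
      t ^ 2 * (D ^ 2 * (5 ^ d * G) * K) := by
    rw [ht, show (4 : ℝ) = 2 * 2 by norm_num, mul_pow]
    field_simp
    ring
  linarith

theorem law_hit_le_law_sumHit {p q r : ℝ} (hp : p ∈ Set.Ioo (0 : ℝ) 1)
    (hq : q ∈ Set.Ioo (0 : ℝ) 1) (hr : r = 2 ^ d * p * q) (hr1 : r < 1) (hp' : 1 < 2 ^ d * p)
    (hq' : 1 < 2 ^ d * q) {n : ℕ} (hn : 1 ≤ n) (B : Set (Fin d → ℕ)) :
    ENNReal.ofReal ((4 ^ d * 5 ^ d * ((1 - (2 ^ d * p)⁻¹)⁻¹ + (1 - (2 ^ d * q)⁻¹)⁻¹))⁻¹ *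
      ((1 - r) / 2)) * law d r {ω | ∃ c ∈ remaining ω n, c ∈ B} ≤
      ((law d p).prod (law d q)) (sumHit n B) := by
  have hp0 := hp.1
  have hq0 := hq.1
  have hr0 : 0 < r := by rw [hr]; positivity
  have hr2 : 0 < 1 - r := by linarith
  have ha1 : (2 ^ d * p)⁻¹ < 1 := inv_lt_one_of_one_lt₀ hp'
  have hb1 : (2 ^ d * q)⁻¹ < 1 := inv_lt_one_of_one_lt₀ hq'
  have hc0 : 0 ≤ (4 ^ d * 5 ^ d * ((1 - (2 ^ d * p)⁻¹)⁻¹ + (1 - (2 ^ d * q)⁻¹)⁻¹))⁻¹ := by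
    have := inv_pos.2 (sub_pos.2 ha1)
    have := inv_pos.2 (sub_pos.2 hb1)
    positivity
  rw [law_hit ⟨hr0.le, hr1.le⟩, ← ENNReal.ofReal_mul (by positivity), ← ofReal_measureReal]
  refine ENNReal.ofReal_le_ofReal (le_trans ?_ (conductance_le_law_sumHit hp hq hr hp' hq' hn B))
  rw [mul_assoc]
  refine mul_le_mul_of_nonneg_left ?_ hc0
  have := mul_le_mul_of_nonneg_left (hitProb_le hr0 hr1 B n 0) (show 0 ≤ (1 - r) / 2 by positivity)
  refine this.trans (le_of_eq ?_)
  field_simp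

/-! ### The discrete percolation -/

lemma mem_cube_iff {n : ℕ} {c : Fin d → ℕ} {x : EuclideanSpace ℝ (Fin d)} :
    x ∈ cube n c ↔ ∀ i, (c i : ℝ) ≤ 2 ^ n * (x i + 1 / 2) ∧ 2 ^ n * (x i + 1 / 2) < c i + 1 := by
  have h2 : (0 : ℝ) < 2 ^ n := by positivity
  refine forall_congr' fun i => and_congr ?_ ?_
  · rw [← div_le_iff₀' h2]
    constructor <;> intro h <;> linarith
  · rw [← lt_div_iff₀' h2]
    constructor <;> intro h <;> linarith

/-- After scaling, a half-open cube has side 1 and an integral lower corner when n ≥ 1, so that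
corner is its only lattice point. -/
lemma mem_discretePercolation {ω : Decisions d} {n : ℕ} (hn : 1 ≤ n) {z : Fin d → ℤ} :
    z ∈ discretePercolation ω n ↔ ∃ c ∈ remaining ω n, ∀ i, z i = (c i : ℤ) - 2 ^ (n - 1) := by
  have h2 : (2 : ℝ) ^ n ≠ 0 := by positivity
  have h3 : (2 : ℝ) ^ n = 2 * 2 ^ (n - 1) := by rw [← pow_succ']; congr 1; omega
  simp only [discretePercolation, Set.mem_ofPred_eq, Set.mem_iUnion,
    Set.mem_smul_set_iff_inv_smul_mem₀ h2, mem_cube_iff]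
  refine exists_congr fun c => ?_
  rw [exists_prop]
  refine and_congr_right fun _ => forall_congr' fun i => ?_
  have e : (2 : ℝ) ^ n * ((((2 : ℝ) ^ n)⁻¹ • WithLp.toLp 2 fun i => (z i : ℝ)) i + 1 / 2) =
      ((z i + 2 ^ (n - 1) : ℤ) : ℝ) := by
    simp only [PiLp.smul_apply, smul_eq_mul]
    push_cast
    rw [mul_add, mul_inv_cancel_left₀ h2, h3]
    ring
  rw [e]
  have : ((c i : ℝ) ≤ ((z i + 2 ^ (n - 1) : ℤ) : ℝ) ∧
      ((z i + 2 ^ (n - 1) : ℤ) : ℝ) < c i + 1) ↔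
      ((c i : ℤ) ≤ z i + 2 ^ (n - 1) ∧ z i + 2 ^ (n - 1) < c i + 1) := by
    constructor
    · rintro ⟨h1, h2⟩; exact ⟨by exact_mod_cast h1, by exact_mod_cast h2⟩
    · rintro ⟨h1, h2⟩; exact ⟨by exact_mod_cast h1, by exact_mod_cast h2⟩
  rw [this]
  constructor
  · rintro ⟨h1, h2⟩; linarith
  · intro h; constructor <;> linarith

/-- The indices of the cubes of generation `n` that correspond to the lattice points in `A`. -/
def latticeIndices (n : ℕ) (A : Set (Fin d → ℤ)) : Set (Fin d → ℕ) :=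
  {c | c ∈ desc n (0 : Fin d → ℕ) ∧ (fun i => (c i : ℤ) - 2 ^ (n - 1)) ∈ A}

lemma discretePercolation_hit {n : ℕ} (hn : 1 ≤ n) (A : Set (Fin d → ℤ)) :
    {ω : Decisions d | (discretePercolation ω n ∩ A).Nonempty} =
      {ω | ∃ c ∈ remaining ω n, c ∈ latticeIndices n A} := by
  ext ω
  simp only [Set.mem_ofPred_eq, Set.Nonempty, Set.mem_inter_iff, mem_discretePercolation hn]
  constructor
  · rintro ⟨z, ⟨c, hc, hz⟩, hA⟩
    exact ⟨c, hc, mem_box_of_mem_remaining hc, (funext hz) ▸ hA⟩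
  · rintro ⟨c, hc, -, hA⟩
    exact ⟨_, ⟨c, hc, fun _ => rfl⟩, hA⟩

/-- Each lattice point is its index minus 2^(n-1). Two summands are shifted twice and the target
once, which leaves the offset 2^(n-1). The box condition on A guarantees that the target has an
index. -/
lemma discretePercolation_sum_hit {n : ℕ} (hn : 1 ≤ n) (A : Set (Fin d → ℤ))
    (hA : ∀ a ∈ A, ∀ i, -2 ^ (n - 1) ≤ a i ∧ a i < 2 ^ (n - 1)) :
    {ω : Decisions d × Decisions d |
      ((discretePercolation ω.1 n + discretePercolation ω.2 n) ∩ A).Nonempty} =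
      sumHit n (latticeIndices n A) := by
  have h3 : (2 : ℤ) ^ n = 2 * 2 ^ (n - 1) := by rw [← pow_succ']; congr 1; omega
  ext ω
  simp only [sumHit, Set.mem_ofPred_eq, Set.Nonempty, Set.mem_inter_iff, Set.mem_add,
    mem_discretePercolation hn]
  constructor
  · rintro ⟨z, ⟨x, ⟨c, hc, hx⟩, y, ⟨c', hc', hy⟩, rfl⟩, hz⟩
    have hw := hA _ hz
    simp only [Pi.add_apply, hx, hy] at hw
    refine ⟨c, hc, c', hc', fun i => c i + c' i - 2 ^ (n - 1), ⟨?_, ?_⟩, fun i => ?_⟩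
    · rw [mem_box]
      intro i
      have := hw i
      zify [show 2 ^ (n - 1) ≤ c i + c' i by zify; linarith]
      linarith
    · convert hz using 1
      funext i
      have := hw i
      rw [Nat.cast_sub (by zify; linarith)]
      simp only [Pi.add_apply, hx, hy]
      push_cast
      ring
    · have := hw i
      rw [Nat.sub_add_cancel]
      zify
      linarith
  · rintro ⟨c, hc, c', hc', a, ⟨_, ha⟩, h⟩
    refine ⟨_, ⟨_, ⟨c, hc, fun _ => rfl⟩, _, ⟨c', hc', fun _ => rfl⟩, rfl⟩, ?_⟩
    convert ha using 1
    funext i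
    have := h i
    zify at this
    simp only [Pi.add_apply]
    linarith

lemma sumHit_subset {n : ℕ} (hn : 1 ≤ n) (B : Set (Fin d → ℕ)) :
    sumHit n B ⊆ {ω | ∃ c ∈ remaining ω.1 n, ∃ c' ∈ remaining ω.2 n,
      ∃ a ∈ B, SumNear 4 n c c' a} := by
  have h3 : (2 : ℤ) ^ n = 2 * 2 ^ (n - 1) := by rw [← pow_succ']; congr 1; omega
  rintro ω ⟨c, hc, c', hc', a, ha, h⟩
  refine ⟨c, hc, c', hc', a, ha, fun i => ?_⟩
  have := h i
  zify at this
  rw [h3, abs_le]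
  constructor <;> linarith

/-! ### Closed cubes -/

lemma closure_cube_eq (n : ℕ) (c : Fin d → ℕ) :
    closure (cube n c) = (PiLp.homeomorph 2 fun _ : Fin d => ℝ) ⁻¹' (Set.univ.pi fun i =>
      Set.Icc (-(1 / 2 : ℝ) + (c i : ℝ) / 2 ^ n) (-(1 / 2 : ℝ) + ((c i : ℝ) + 1) / 2 ^ n)) := by
  have e : cube n c = (PiLp.homeomorph 2 fun _ : Fin d => ℝ) ⁻¹' (Set.univ.pi fun i =>
      Set.Ico (-(1 / 2 : ℝ) + (c i : ℝ) / 2 ^ n) (-(1 / 2 : ℝ) + ((c i : ℝ) + 1) / 2 ^ n)) := by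
    ext x
    simp only [cube, Set.mem_preimage, Set.mem_univ_pi, Set.mem_Ico]
    rfl
  have hlt : ∀ i, -(1 / 2 : ℝ) + (c i : ℝ) / 2 ^ n ≠ -(1 / 2 : ℝ) + ((c i : ℝ) + 1) / 2 ^ n := by
    intro i h
    have : (c i : ℝ) / 2 ^ n < ((c i : ℝ) + 1) / 2 ^ n := by gcongr; linarith
    linarith
  rw [e, ← Homeomorph.preimage_closure, closure_pi_set]
  simp only [closure_Ico (hlt _)]

lemma mem_closure_cube {n : ℕ} {c : Fin d → ℕ} {x : EuclideanSpace ℝ (Fin d)} :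
    x ∈ closure (cube n c) ↔
      ∀ i, (c i : ℝ) ≤ 2 ^ n * (x i + 1 / 2) ∧ 2 ^ n * (x i + 1 / 2) ≤ c i + 1 := by
  have h2 : (0 : ℝ) < 2 ^ n := by positivity
  have hx : ∀ i, (PiLp.homeomorph 2 fun _ : Fin d => ℝ) x i = x i := fun _ => rfl
  rw [closure_cube_eq]
  simp only [Set.mem_preimage, Set.mem_univ_pi, Set.mem_Icc, hx]
  refine forall_congr' fun i => and_congr ?_ ?_
  · rw [← div_le_iff₀' h2]
    constructor <;> intro h <;> linarith
  · rw [← le_div_iff₀' h2]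
    constructor <;> intro h <;> linarith

lemma closure_cube_subset {h k : ℕ} (c : Fin d → ℕ) :
    closure (cube (k + h) c) ⊆ closure (cube k (anc h c)) := by
  intro x hx
  rw [mem_closure_cube] at hx ⊢
  intro i
  obtain ⟨h1, h2⟩ := hx i
  have hT : (0 : ℝ) < 2 ^ h := by positivity
  have l1 : (anc h c i : ℝ) * 2 ^ h ≤ c i := by exact_mod_cast Nat.div_mul_le_self _ _
  have l2 : (c i : ℝ) + 1 ≤ (anc h c i + 1) * 2 ^ h := by
    have : c i < (anc h c i + 1) * 2 ^ h := by
      rw [← Nat.div_lt_iff_lt_mul (by positivity)]; exact Nat.lt_succ_self _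
    exact_mod_cast this
  rw [pow_add] at h1 h2
  constructor
  · refine le_of_mul_le_mul_right ?_ hT; linarith
  · refine le_of_mul_le_mul_right ?_ hT; linarith

/-- The index of a cube of generation `n` whose closure contains `x`. -/
noncomputable def index (n : ℕ) (x : EuclideanSpace ℝ (Fin d)) : Fin d → ℕ :=
  fun i => min ⌊2 ^ n * (x i + 1 / 2)⌋₊ (2 ^ n - 1)

lemma index_mem_box (n : ℕ) (x : EuclideanSpace ℝ (Fin d)) :
    index n x ∈ desc n (0 : Fin d → ℕ) := by
  rw [mem_box]
  intro i
  have : 0 < 2 ^ n := by positivity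
  have := min_le_right ⌊(2 : ℝ) ^ n * (x i + 1 / 2)⌋₊ (2 ^ n - 1)
  simp only [index]
  omega

lemma measurable_index (n : ℕ) : Measurable (index n : EuclideanSpace ℝ (Fin d) → _) := by
  refine measurable_pi_lambda _ fun i => ?_
  unfold index
  have : Measurable fun x : EuclideanSpace ℝ (Fin d) => ⌊(2 : ℝ) ^ n * (x i + 1 / 2)⌋₊ :=
    Nat.measurable_floor.comp (by fun_prop)
  exact this.min measurable_const

/-- The truncation at 2^n - 1 in `index` serves points on the upper faces; it is compatible with
passing to ancestors because (2^(k+h) - 1) / 2^h = 2^k - 1 in natural numbers. -/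
lemma anc_index (h k : ℕ) (x : EuclideanSpace ℝ (Fin d)) : anc h (index (k + h) x) = index k x := by
  funext i
  simp only [anc, index]
  have e : ⌊(2 : ℝ) ^ k * (x i + 1 / 2)⌋₊ = ⌊(2 : ℝ) ^ (k + h) * (x i + 1 / 2)⌋₊ / 2 ^ h := by
    rw [← Nat.floor_div_natCast]
    congr 1
    push_cast
    rw [pow_add]
    field_simp
  rw [e]
  have hT : 0 < 2 ^ h := by positivity
  have h2 : (2 ^ (k + h) - 1) / 2 ^ h = 2 ^ k - 1 := by
    rw [pow_add]
    have hk : 0 < 2 ^ k := by positivity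
    rw [Nat.div_eq_of_lt_le]
    · rw [Nat.sub_mul, one_mul]; omega
    · rw [Nat.sub_add_cancel hk]
      have := Nat.mul_pos hk hT
      omega
  rw [← h2]
  rcases le_total ⌊(2 : ℝ) ^ (k + h) * (x i + 1 / 2)⌋₊ (2 ^ (k + h) - 1) with hle | hle
  · rw [min_eq_left hle, min_eq_left (Nat.div_le_div_right hle)]
  · rw [min_eq_right hle, min_eq_right (Nat.div_le_div_right hle)]

lemma mem_closure_cube_index {x : EuclideanSpace ℝ (Fin d)}
    (hx : ∀ i, x i ∈ Set.Icc (-(1 / 2) : ℝ) (1 / 2)) (n : ℕ) : x ∈ closure (cube n (index n x)) := by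
  rw [mem_closure_cube]
  intro i
  obtain ⟨h1, h2⟩ := hx i
  have hT : (0 : ℝ) < 2 ^ n := by positivity
  have hy : 0 ≤ (2 : ℝ) ^ n * (x i + 1 / 2) := mul_nonneg hT.le (by linarith)
  have hy2 : (2 : ℝ) ^ n * (x i + 1 / 2) ≤ 2 ^ n := by nlinarith
  have hN : (((2 ^ n - 1 : ℕ) : ℝ)) = 2 ^ n - 1 := by
    rw [Nat.cast_sub Nat.one_le_two_pow]; simp
  simp only [index]
  rcases le_total ⌊(2 : ℝ) ^ n * (x i + 1 / 2)⌋₊ (2 ^ n - 1) with hle | hle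
  · rw [min_eq_left hle]
    exact ⟨Nat.floor_le hy, (Nat.lt_floor_add_one _).le⟩
  · rw [min_eq_right hle, hN]
    refine ⟨?_, by linarith⟩
    rw [← hN]
    exact (Nat.cast_le.2 hle).trans (Nat.floor_le hy)

/-! ### The continuous percolation as a limit -/

/-- The cubes of generation `n` whose closures meet `Λ`. -/
def meeting (n : ℕ) (Λ : Set (EuclideanSpace ℝ (Fin d))) : Set (Fin d → ℕ) :=
  {c | c ∈ desc n (0 : Fin d → ℕ) ∧ (closure (cube n c) ∩ Λ).Nonempty}

/-- The union of the closures of the remaining cubes of generation `n`. -/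
def approx (ω : Decisions d) (n : ℕ) : Set (EuclideanSpace ℝ (Fin d)) :=
  ⋃ c ∈ remaining ω n, closure (cube n c)

lemma percolation_eq (ω : Decisions d) : percolation ω = ⋂ n, approx ω (n + 1) := by
  ext x
  simp only [percolation, approx, Set.mem_iInter]
  constructor
  · intro h n; exact h (n + 1) (by omega)
  · intro h n hn; obtain ⟨m, rfl⟩ := Nat.exists_eq_add_of_le' hn; exact h m

lemma approx_succ_subset (ω : Decisions d) (n : ℕ) : approx ω (n + 1) ⊆ approx ω n := by
  refine Set.iUnion₂_subset fun c hc => ?_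
  refine (closure_cube_subset (h := 1) (k := n) c).trans ?_
  exact Set.subset_biUnion_of_mem (u := fun c => closure (cube n c))
    (by simpa using anc_mem_remaining (h := 1) (by omega) hc)

lemma isCompact_closure_cube (n : ℕ) (c : Fin d → ℕ) : IsCompact (closure (cube n c)) := by
  rw [closure_cube_eq, Homeomorph.isCompact_preimage]
  exact isCompact_univ_pi fun i => isCompact_Icc

lemma isCompact_approx (ω : Decisions d) (n : ℕ) : IsCompact (approx ω n) :=
  ((desc n (0 : Fin d → ℕ)).finite_toSet.subset fun _ hc => mem_box_of_mem_remaining hc).isCompact_biUnion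
    fun c _ => isCompact_closure_cube n c

lemma percolation_hit_iff {Λ : Set (EuclideanSpace ℝ (Fin d))} (hΛ : IsClosed Λ)
    (ω : Decisions d) : (percolation ω ∩ Λ).Nonempty ↔ ∀ n, (approx ω (n + 1) ∩ Λ).Nonempty := by
  rw [percolation_eq, Set.iInter_inter]
  constructor
  · rintro ⟨x, hx⟩ n
    exact ⟨x, Set.mem_iInter.1 hx n⟩
  · intro h
    exact IsCompact.nonempty_iInter_of_sequence_nonempty_isCompact_isClosed _
      (fun n => Set.inter_subset_inter_left _ (approx_succ_subset ω _)) h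
      ((isCompact_approx ω _).inter_right hΛ) fun n => (isCompact_approx ω _).isClosed.inter hΛ

/-- Compactness is applied to pairs of summands rather than to the Minkowski sums, so that the limit
point comes with its decomposition. -/
lemma percolation_sum_hit_iff {Λ : Set (EuclideanSpace ℝ (Fin d))} (hΛ : IsClosed Λ)
    (ω : Decisions d × Decisions d) : ((percolation ω.1 + percolation ω.2) ∩ Λ).Nonempty ↔
      ∀ n, ((approx ω.1 (n + 1) + approx ω.2 (n + 1)) ∩ Λ).Nonempty := by
  constructor
  · rintro ⟨_, ⟨x, hx, y, hy, rfl⟩, hxy⟩ n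
    rw [percolation_eq, Set.mem_iInter] at hx hy
    exact ⟨_, ⟨x, hx n, y, hy n, rfl⟩, hxy⟩
  · intro h
    set F : ℕ → Set (EuclideanSpace ℝ (Fin d) × EuclideanSpace ℝ (Fin d)) := fun n =>
      (approx ω.1 (n + 1) ×ˢ approx ω.2 (n + 1)) ∩ {z | z.1 + z.2 ∈ Λ} with hF
    have hcl : IsClosed {z : EuclideanSpace ℝ (Fin d) × EuclideanSpace ℝ (Fin d) |
        z.1 + z.2 ∈ Λ} := hΛ.preimage (by fun_prop)
    obtain ⟨z, hz⟩ := IsCompact.nonempty_iInter_of_sequence_nonempty_isCompact_isClosed F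
      (fun n => Set.inter_subset_inter_left _
        (Set.prod_mono (approx_succ_subset _ _) (approx_succ_subset _ _)))
      (fun n => by
        obtain ⟨_, ⟨x, hx, y, hy, rfl⟩, hxy⟩ := h n
        exact ⟨(x, y), ⟨hx, hy⟩, hxy⟩)
      (((isCompact_approx _ _).prod (isCompact_approx _ _)).inter_right hcl)
      (fun n => ((isCompact_approx _ _).isClosed.prod (isCompact_approx _ _).isClosed).inter hcl)
    rw [Set.mem_iInter] at hz
    refine ⟨z.1 + z.2, ⟨z.1, ?_, z.2, ?_, rfl⟩, (hz 0).2⟩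
    · rw [percolation_eq, Set.mem_iInter]; exact fun n => (hz n).1.1
    · rw [percolation_eq, Set.mem_iInter]; exact fun n => (hz n).1.2

lemma approx_hit_iff (ω : Decisions d) (n : ℕ) (Λ : Set (EuclideanSpace ℝ (Fin d))) :
    (approx ω n ∩ Λ).Nonempty ↔ ∃ c ∈ remaining ω n, c ∈ meeting n Λ := by
  simp only [approx, Set.iUnion_inter, Set.nonempty_iUnion, meeting, Set.mem_ofPred_eq]
  constructor
  · rintro ⟨c, hc, h⟩; exact ⟨c, hc, mem_box_of_mem_remaining hc, h⟩
  · rintro ⟨c, hc, -, h⟩; exact ⟨c, hc, h⟩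

lemma approx_sum_hit_iff (ω : Decisions d × Decisions d) (n : ℕ)
    (Λ : Set (EuclideanSpace ℝ (Fin d))) :
    ((approx ω.1 n + approx ω.2 n) ∩ Λ).Nonempty ↔ ∃ c ∈ remaining ω.1 n, ∃ c' ∈ remaining ω.2 n,
      ((closure (cube n c) + closure (cube n c')) ∩ Λ).Nonempty := by
  constructor
  · rintro ⟨_, ⟨x, hx, y, hy, rfl⟩, hxy⟩
    simp only [approx, Set.mem_iUnion, exists_prop] at hx hy
    obtain ⟨c, hc, hx⟩ := hx
    obtain ⟨c', hc', hy⟩ := hy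
    exact ⟨c, hc, c', hc', _, ⟨x, hx, y, hy, rfl⟩, hxy⟩
  · rintro ⟨c, hc, c', hc', _, ⟨x, hx, y, hy, rfl⟩, hxy⟩
    exact ⟨_, ⟨x, Set.mem_biUnion hc hx, y, Set.mem_biUnion hc' hy, rfl⟩, hxy⟩

/-- The sum of two percolations can only hit `Λ` near the cubes meeting `Λ`. -/
lemma sumNear_of_sum_hit {Λ : Set (EuclideanSpace ℝ (Fin d))}
    (hΛ : ∀ x ∈ Λ, ∀ i, x i ∈ Set.Icc (-(1 / 2) : ℝ) (1 / 2)) {n : ℕ} {c c' : Fin d → ℕ}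
    (h : ((closure (cube n c) + closure (cube n c')) ∩ Λ).Nonempty) :
    ∃ a ∈ meeting n Λ, SumNear 4 n c c' a := by
  obtain ⟨_, ⟨x, hx, y, hy, rfl⟩, hxy⟩ := h
  have hv := mem_closure_cube_index (hΛ _ hxy) n
  refine ⟨_, ⟨index_mem_box n _, _, hv, hxy⟩, fun i => ?_⟩
  rw [mem_closure_cube] at hx hy hv
  obtain ⟨x1, x2⟩ := hx i
  obtain ⟨y1, y2⟩ := hy i
  obtain ⟨v1, v2⟩ := hv i
  simp only [PiLp.add_apply] at v1 v2
  set v := index n ((fun x y => x + y) x y) i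
  rw [← Int.cast_le (R := ℝ)]
  push_cast
  rw [abs_le]
  constructor <;> linarith

/-- If `a` is a cube meeting `Λ`, then pairs of cubes that sum up to `a` have sums meeting `Λ`. -/
lemma sum_hit_of_add_eq {Λ : Set (EuclideanSpace ℝ (Fin d))} {n : ℕ} (hn : 1 ≤ n)
    {c c' a : Fin d → ℕ} (ha : a ∈ meeting n Λ) (h : ∀ i, c i + c' i = a i + 2 ^ (n - 1)) :
    ((closure (cube n c) + closure (cube n c')) ∩ Λ).Nonempty := by
  have h3 : (2 : ℝ) ^ n = 2 * 2 ^ (n - 1) := by rw [← pow_succ']; congr 1; omega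
  have hT : (0 : ℝ) < 2 ^ n := by positivity
  obtain ⟨-, x, hx, hxΛ⟩ := ha
  -- Taking z to be the lower corner of c' makes x - z a translate of x from the cube a into the
  -- cube c.
  set z : EuclideanSpace ℝ (Fin d) := WithLp.toLp 2 fun i => -(1 / 2) + (c' i : ℝ) / 2 ^ n with hz
  have hzi : ∀ i, z i = -(1 / 2) + (c' i : ℝ) / 2 ^ n := fun i => rfl
  refine ⟨x, ⟨x - z, ?_, z, ?_, sub_add_cancel x z⟩, hxΛ⟩
  · rw [mem_closure_cube] at hx ⊢
    intro i
    obtain ⟨h1, h2⟩ := hx i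
    have hi : (c i : ℝ) + c' i = a i + 2 ^ (n - 1) := by exact_mod_cast h i
    have e : (2 : ℝ) ^ n * ((x - z) i + 1 / 2) = 2 ^ n * (x i + 1 / 2) + 2 ^ n / 2 - c' i := by
      rw [PiLp.sub_apply, hzi]; field_simp; ring
    rw [e, h3]
    rw [h3] at h1 h2
    constructor <;> linarith
  · rw [mem_closure_cube]
    intro i
    have e : (2 : ℝ) ^ n * (z i + 1 / 2) = c' i := by
      rw [hzi]; field_simp; ring
    rw [e]
    constructor <;> linarith

/-- If all of a decreasing sequence of events have probability at least `a`, so has their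
intersection. -/
lemma le_measure_iInter {Ω : Type*} [MeasurableSpace Ω] (P : Measure Ω) [IsProbabilityMeasure P]
    {E : ℕ → Set Ω} (hE : ∀ n, MeasurableSet (E n)) (hanti : ∀ n, E (n + 1) ⊆ E n) {a : ℝ≥0∞}
    (ha : ∀ n, a ≤ P (E n)) : a ≤ P (⋂ n, E n) :=
  ge_of_tendsto' (tendsto_measure_iInter_atTop (fun n => (hE n).nullMeasurableSet)
    (antitone_nat_of_succ_le hanti) ⟨0, measure_ne_top _ _⟩) ha

lemma percolation_hit_eq {Λ : Set (EuclideanSpace ℝ (Fin d))} (hΛ : IsClosed Λ) :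
    {ω : Decisions d | (percolation ω ∩ Λ).Nonempty} =
      ⋂ n, {ω | ∃ c ∈ remaining ω (n + 1), c ∈ meeting (n + 1) Λ} := by
  ext ω
  simp [percolation_hit_iff hΛ, approx_hit_iff]

lemma law_percolation_hit_le {p : ℝ} {Λ : Set (EuclideanSpace ℝ (Fin d))} (hΛ : IsClosed Λ)
    {n : ℕ} (hn : 1 ≤ n) : law d p {ω | (percolation ω ∩ Λ).Nonempty} ≤
      law d p {ω | ∃ c ∈ remaining ω n, c ∈ meeting n Λ} := by
  obtain ⟨m, rfl⟩ := Nat.exists_eq_add_of_le' hn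
  rw [percolation_hit_eq hΛ]
  exact measure_mono (Set.iInter_subset _ m)

lemma le_law_percolation_hit {p : ℝ} {Λ : Set (EuclideanSpace ℝ (Fin d))} (hΛ : IsClosed Λ)
    {a : ℝ≥0∞} (ha : ∀ n, 1 ≤ n → a ≤ law d p {ω | ∃ c ∈ remaining ω n, c ∈ meeting n Λ}) :
    a ≤ law d p {ω | (percolation ω ∩ Λ).Nonempty} := by
  rw [percolation_hit_eq hΛ]
  refine le_measure_iInter _ (fun n => ?_) (fun n ω hω => ?_) fun n => ha _ (by omega)
  · have : {ω : Decisions d | ∃ c ∈ remaining ω (n + 1), c ∈ meeting (n + 1) Λ} =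
        ⋃ c ∈ meeting (n + 1) Λ, {ω | c ∈ remaining ω (n + 1)} := by
      ext ω; simp [and_comm]
    rw [this]
    exact .biUnion (Set.to_countable _) fun c _ => measurableSet_remaining _ c
  · rw [Set.mem_ofPred_eq, ← approx_hit_iff] at hω ⊢
    exact hω.mono (Set.inter_subset_inter_left _ (approx_succ_subset _ _))

lemma sum_percolation_hit_eq {Λ : Set (EuclideanSpace ℝ (Fin d))} (hΛ : IsClosed Λ) :
    {ω : Decisions d × Decisions d | ((percolation ω.1 + percolation ω.2) ∩ Λ).Nonempty} =
      ⋂ n, {ω | ∃ c ∈ remaining ω.1 (n + 1), ∃ c' ∈ remaining ω.2 (n + 1),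
        ((closure (cube (n + 1) c) + closure (cube (n + 1) c')) ∩ Λ).Nonempty} := by
  ext ω
  simp only [Set.mem_ofPred_eq, Set.mem_iInter, percolation_sum_hit_iff hΛ, approx_sum_hit_iff]

lemma law_sum_percolation_hit_le {p q : ℝ} {Λ : Set (EuclideanSpace ℝ (Fin d))} (hΛ : IsClosed Λ)
    (hΛ' : ∀ x ∈ Λ, ∀ i, x i ∈ Set.Icc (-(1 / 2) : ℝ) (1 / 2)) {n : ℕ} (hn : 1 ≤ n) :
    ((law d p).prod (law d q)) {ω | ((percolation ω.1 + percolation ω.2) ∩ Λ).Nonempty} ≤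
      ((law d p).prod (law d q)) {ω | ∃ c ∈ remaining ω.1 n, ∃ c' ∈ remaining ω.2 n,
        ∃ a ∈ meeting n Λ, SumNear 4 n c c' a} := by
  obtain ⟨m, rfl⟩ := Nat.exists_eq_add_of_le' hn
  rw [sum_percolation_hit_eq hΛ]
  refine measure_mono ((Set.iInter_subset _ m).trans ?_)
  rintro ω ⟨c, hc, c', hc', h⟩
  exact ⟨c, hc, c', hc', sumNear_of_sum_hit hΛ' h⟩

lemma le_law_sum_percolation_hit {p q : ℝ} {Λ : Set (EuclideanSpace ℝ (Fin d))} (hΛ : IsClosed Λ)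
    {a : ℝ≥0∞} (ha : ∀ n, 1 ≤ n → a ≤ ((law d p).prod (law d q)) (sumHit n (meeting n Λ))) :
    a ≤ ((law d p).prod (law d q))
      {ω | ((percolation ω.1 + percolation ω.2) ∩ Λ).Nonempty} := by
  rw [sum_percolation_hit_eq hΛ]
  refine le_measure_iInter _ (fun n => measurableSet_sum_hit _ _) (fun n ω hω => ?_)
    fun n => (ha (n + 1) (by omega)).trans (measure_mono ?_)
  · rw [Set.mem_ofPred_eq, ← approx_sum_hit_iff] at hω ⊢
    exact hω.mono (Set.inter_subset_inter_left _
      (Set.add_subset_add (approx_succ_subset _ _) (approx_succ_subset _ _)))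
  · rintro ω ⟨c, hc, c', hc', a, ha, h⟩
    exact ⟨c, hc, c', hc', sum_hit_of_add_eq (by omega) ha h⟩

/-! ### Energies of measures at dyadic scales -/

/-- A multiscale kernel associated with a family of sets at each scale. -/
noncomputable def levelKernel (r : ℝ) (A : ℕ → (Fin d → ℕ) → Set (EuclideanSpace ℝ (Fin d)))
    (x y : EuclideanSpace ℝ (Fin d)) : ℝ≥0∞ :=
  ∑' k, ∑ v ∈ desc k (0 : Fin d → ℕ),
    ENNReal.ofReal (r ^ k)⁻¹ * ((A k v).indicator 1 x * (A k v).indicator 1 y)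

lemma lintegral_levelKernel (r : ℝ) {A : ℕ → (Fin d → ℕ) → Set (EuclideanSpace ℝ (Fin d))}
    (hA : ∀ k v, MeasurableSet (A k v)) (ν : Measure (EuclideanSpace ℝ (Fin d))) :
    ∫⁻ x, ∫⁻ y, levelKernel r A x y ∂ν ∂ν =
      ∑' k, ∑ v ∈ desc k (0 : Fin d → ℕ), ENNReal.ofReal (r ^ k)⁻¹ * ν (A k v) ^ 2 := by
  have hi : ∀ k v, Measurable ((A k v).indicator (1 : EuclideanSpace ℝ (Fin d) → ℝ≥0∞)) :=
    fun k v => measurable_one.indicator (hA k v)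
  have h1 : ∀ x, ∫⁻ y, levelKernel r A x y ∂ν = ∑' k, ∑ v ∈ desc k (0 : Fin d → ℕ),
      ENNReal.ofReal (r ^ k)⁻¹ * ((A k v).indicator 1 x * ν (A k v)) := by
    intro x
    unfold levelKernel
    rw [lintegral_tsum fun k => (Finset.measurable_sum _ fun v _ =>
      ((hi k v).const_mul _).const_mul _).aemeasurable]
    refine tsum_congr fun k => ?_
    rw [lintegral_finsetSum _ fun v _ => ((hi k v).const_mul _).const_mul _]
    refine Finset.sum_congr rfl fun v _ => ?_
    rw [lintegral_const_mul _ ((hi k v).const_mul _), lintegral_const_mul _ (hi k v),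
      lintegral_indicator_one (hA k v)]
  simp_rw [h1]
  rw [lintegral_tsum fun k => (Finset.measurable_sum _ fun v _ =>
      ((hi k v).mul_const _).const_mul _).aemeasurable]
  refine tsum_congr fun k => ?_
  rw [lintegral_finsetSum _ fun v _ => ((hi k v).mul_const _).const_mul _]
  refine Finset.sum_congr rfl fun v _ => ?_
  rw [lintegral_const_mul _ ((hi k v).mul_const _), lintegral_mul_const _ (hi k v),
    lintegral_indicator_one (hA k v), sq]

lemma dist_le_of_index_eq {x y : EuclideanSpace ℝ (Fin d)}
    (hx : ∀ i, x i ∈ Set.Icc (-(1 / 2) : ℝ) (1 / 2))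
    (hy : ∀ i, y i ∈ Set.Icc (-(1 / 2) : ℝ) (1 / 2)) {k : ℕ} (h : index k x = index k y) :
    dist x y ≤ d / 2 ^ k := by
  have hT : (0 : ℝ) < 2 ^ k := by positivity
  have hi : ∀ i, dist (x i) (y i) ^ 2 ≤ (1 / 2 ^ k) ^ 2 := by
    intro i
    have h1 := mem_closure_cube.1 (mem_closure_cube_index hx k) i
    have h2 := mem_closure_cube.1 (mem_closure_cube_index hy k) i
    rw [h] at h1
    refine pow_le_pow_left₀ dist_nonneg ?_ 2
    rw [Real.dist_eq, le_div_iff₀ hT, ← abs_of_pos hT, ← abs_mul, abs_le]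
    constructor <;> linarith
  rw [EuclideanSpace.dist_eq]
  refine Real.sqrt_le_iff.2 ⟨by positivity, ?_⟩
  refine (Finset.sum_le_sum fun i _ => hi i).trans ?_
  rw [Finset.sum_const, Finset.card_univ, Fintype.card_fin, nsmul_eq_mul, div_pow, div_pow, one_pow,
    mul_one_div]
  gcongr
  exact_mod_cast Nat.le_self_pow two_ne_zero d

/-- The terms grow geometrically, so the sum is controlled by its largest term, which is at most X.
-/
lemma sum_inv_pow_le {r X : ℝ} (hr0 : 0 < r) (hr1 : r < 1) (hX : 0 ≤ X) (s : Finset ℕ)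
    (hs : ∀ k ∈ s, (r ^ k)⁻¹ ≤ X) : ∑ k ∈ s, (r ^ k)⁻¹ ≤ X / (1 - r) := by
  rcases s.eq_empty_or_nonempty with rfl | hne
  · simp only [Finset.sum_empty]
    exact div_nonneg hX (by linarith)
  set m := s.max' hne
  have hsub : s ⊆ Finset.range (m + 1) := fun k hk =>
    Finset.mem_range.2 (Nat.lt_succ_of_le (s.le_max' k hk))
  have h1 : ∑ k ∈ s, (r ^ k)⁻¹ ≤ ∑ k ∈ Finset.range (m + 1), (r ^ k)⁻¹ :=
    Finset.sum_le_sum_of_subset_of_nonneg hsub fun _ _ _ => by positivity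
  have h2 : ∑ k ∈ Finset.range (m + 1), (r ^ k)⁻¹ =
      (r ^ m)⁻¹ * ∑ k ∈ Finset.range (m + 1), r ^ k := by
    rw [← Finset.sum_range_reflect, Finset.mul_sum]
    refine Finset.sum_congr rfl fun k hk => ?_
    rw [Finset.mem_range] at hk
    obtain ⟨i, hi⟩ := Nat.exists_eq_add_of_le (Nat.lt_succ_iff.1 hk)
    rw [show m + 1 - 1 - k = i by omega, hi, pow_add]
    field_simp
  have h3 : ∑ k ∈ Finset.range (m + 1), r ^ k ≤ (1 - r)⁻¹ := by
    rw [← tsum_geometric_of_lt_one hr0.le hr1]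
    exact (summable_geometric_of_lt_one hr0.le hr1).sum_le_tsum _ fun i _ => pow_nonneg hr0.le i
  rw [div_eq_mul_inv]
  exact h1.trans (h2.le.trans (mul_le_mul (hs m (s.max'_mem hne)) h3
    (Finset.sum_nonneg fun k _ => pow_nonneg hr0.le k) hX))

/-- The relation between the parameter of a fractal percolation and the exponent of the kernel. -/
lemma inv_pow_eq_rpow {r β : ℝ} (hβ : (2 : ℝ) ^ β = r⁻¹) (k : ℕ) :
    (r ^ k)⁻¹ = ((2 : ℝ) ^ k) ^ β := by
  rw [← inv_pow, ← hβ, ← Real.rpow_natCast, ← Real.rpow_natCast, ← Real.rpow_mul two_pos.le,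
    ← Real.rpow_mul two_pos.le, mul_comm]

/-- Points sharing a cube of generation k are at distance at most d/2^k, so every contributing
r^(-k) = 2^(kβ) is at most (d/|x-y|)^β. Summing geometrically costs 1/(1 - r). -/
lemma levelKernel_index_le (hd : 1 ≤ d) {r β : ℝ} (hr0 : 0 < r) (hr1 : r < 1) (hβ0 : 0 < β)
    (hβ : (2 : ℝ) ^ β = r⁻¹) {x y : EuclideanSpace ℝ (Fin d)}
    (hx : ∀ i, x i ∈ Set.Icc (-(1 / 2) : ℝ) (1 / 2))
    (hy : ∀ i, y i ∈ Set.Icc (-(1 / 2) : ℝ) (1 / 2)) :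
    levelKernel r (fun k v => index k ⁻¹' {v}) x y ≤
      ENNReal.ofReal ((d : ℝ) ^ β / (1 - r)) * edist x y ^ (-β) := by
  classical
  have hr2 : 0 < 1 - r := by linarith
  have hd0 : (0 : ℝ) < d := by exact_mod_cast hd
  have hC : 0 < (d : ℝ) ^ β / (1 - r) := by positivity
  rcases eq_or_ne x y with rfl | hxy
  · rw [edist_self, ENNReal.zero_rpow_of_neg (by linarith), ENNReal.mul_top]
    · exact le_top
    · exact (ENNReal.ofReal_pos.2 hC).ne'
  have hδ : 0 < dist x y := dist_pos.2 hxy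
  rw [edist_dist, ENNReal.ofReal_rpow_of_pos hδ, ← ENNReal.ofReal_mul hC.le]
  have hlev : ∀ k, ∑ v ∈ desc k (0 : Fin d → ℕ), ENNReal.ofReal (r ^ k)⁻¹ *
      ((index k ⁻¹' {v}).indicator 1 x * (index k ⁻¹' {v}).indicator 1 y) =
      ENNReal.ofReal (if index k x = index k y then (r ^ k)⁻¹ else 0) := by
    intro k
    rw [Finset.sum_eq_single_of_mem (index k x) (index_mem_box k x)]
    · by_cases h : index k x = index k y
      · simp [h]
      · simp [h, Ne.symm h]
    · intro v _ hv
      simp [Ne.symm hv]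
  unfold levelKernel
  simp_rw [hlev]
  refine ENNReal.tsum_le_of_sum_range_le fun n => ?_
  rw [← ENNReal.ofReal_sum_of_nonneg fun k _ => by positivity]
  refine ENNReal.ofReal_le_ofReal ?_
  rw [← Finset.sum_filter, div_mul_eq_mul_div]
  refine sum_inv_pow_le hr0 hr1 (by positivity) _ fun k hk => ?_
  have hk := dist_le_of_index_eq hx hy (Finset.mem_filter.1 hk).2
  rw [inv_pow_eq_rpow hβ, Real.rpow_neg hδ.le, ← div_eq_mul_inv, ← Real.div_rpow hd0.le hδ.le]
  refine Real.rpow_le_rpow (by positivity) ?_ hβ0.le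
  rw [le_div_iff₀ hδ, ← le_div_iff₀' (by positivity)]
  exact hk

/-! ### Capacity bounds the hitting probability from below -/

lemma one_le_law_hit_mul_energy (hd : 1 ≤ d) {r β : ℝ} (hr0 : 0 < r) (hr1 : r < 1) (hβ0 : 0 < β)
    (hβ : (2 : ℝ) ^ β = r⁻¹) {Λ : Set (EuclideanSpace ℝ (Fin d))}
    (hΛ : ∀ x ∈ Λ, ∀ i, x i ∈ Set.Icc (-(1 / 2) : ℝ) (1 / 2))
    (ν : Measure (EuclideanSpace ℝ (Fin d))) [IsProbabilityMeasure ν] (hν : ν Λᶜ = 0) (n : ℕ) :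
    1 ≤ law d r {ω | ∃ c ∈ remaining ω n, c ∈ meeting n Λ} *
      (ENNReal.ofReal ((d : ℝ) ^ β / (1 - r)) * ∫⁻ x, ∫⁻ y, edist x y ^ (-β) ∂ν ∂ν) := by
  set A : ℕ → (Fin d → ℕ) → Set (EuclideanSpace ℝ (Fin d)) := fun k v => index k ⁻¹' {v} with hA
  have hAm : ∀ k v, MeasurableSet (A k v) := fun k v => measurable_index k (measurableSet_singleton v)
  have hdesc : ∀ {h}, h ≤ n → ∀ v : Fin d → ℕ,
      ∑ b ∈ desc h v, ν.real (A n b) = ν.real (A (n - h) v) := by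
    intro h hh v
    rw [sum_measureReal_preimage_singleton _ fun b _ => hAm n b]
    congr 1
    ext x
    have := anc_index h (n - h) x
    rw [Nat.sub_add_cancel hh] at this
    simp [hA, this]
  -- A measure on Λ is a unit flow: a leaf receives the mass of the points with that index, and it
  -- vanishes outside the cubes meeting Λ.
  have h1 := one_le_conductance_mul_energy hr0 (meeting n Λ) n 0 (fun b => ν.real (A n b)) ?_ ?_
  rotate_left
  · intro b hb
    have : A n b ⊆ Λᶜ := by
      intro x hx hxΛ
      have hxb : index n x = b := hx
      exact hb (hxb ▸ ⟨index_mem_box n x, x, mem_closure_cube_index (hΛ x hxΛ) n, hxΛ⟩)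
    simp [Measure.real, measure_mono_null this hν]
  · rw [hdesc le_rfl, Nat.sub_self]
    have : A 0 (0 : Fin d → ℕ) = Set.univ := by
      refine Set.eq_univ_of_forall fun x => ?_
      have h : index 0 x = 0 := by simpa [desc_zero] using index_mem_box 0 x
      exact h
    rw [this, probReal_univ]
  have h2 : ∑ h ∈ Finset.range (n + 1), ∑ v ∈ desc (n - h) (0 : Fin d → ℕ),
      (r ^ (n - h))⁻¹ * (∑ b ∈ desc h v, ν.real (A n b)) ^ 2 =
      ∑ k ∈ Finset.range (n + 1), ∑ v ∈ desc k (0 : Fin d → ℕ), (r ^ k)⁻¹ * ν.real (A k v) ^ 2 := by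
    rw [← Finset.sum_range_reflect (fun k => ∑ v ∈ desc k (0 : Fin d → ℕ),
      (r ^ k)⁻¹ * ν.real (A k v) ^ 2)]
    refine Finset.sum_congr rfl fun h hh => ?_
    rw [Finset.mem_range] at hh
    rw [show n + 1 - 1 - h = n - h by omega]
    refine Finset.sum_congr rfl fun v _ => ?_
    rw [hdesc (by omega)]
  rw [h2] at h1
  have h3 : ENNReal.ofReal (∑ k ∈ Finset.range (n + 1), ∑ v ∈ desc k (0 : Fin d → ℕ),
      (r ^ k)⁻¹ * ν.real (A k v) ^ 2) ≤ ∫⁻ x, ∫⁻ y, levelKernel r A x y ∂ν ∂ν := by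
    rw [lintegral_levelKernel r hAm]
    refine le_trans (le_of_eq ?_) (ENNReal.sum_le_tsum (Finset.range (n + 1)))
    rw [ENNReal.ofReal_sum_of_nonneg fun k _ => Finset.sum_nonneg fun v _ => by positivity]
    refine Finset.sum_congr rfl fun k _ => ?_
    rw [ENNReal.ofReal_sum_of_nonneg fun v _ => by positivity]
    refine Finset.sum_congr rfl fun v _ => ?_
    rw [ENNReal.ofReal_mul (by positivity), ENNReal.ofReal_pow measureReal_nonneg,
      ofReal_measureReal]
  have hae : ∀ᵐ x ∂ν, x ∈ Λ := by rwa [ae_iff]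
  have h4 : ∫⁻ x, ∫⁻ y, levelKernel r A x y ∂ν ∂ν ≤
      ENNReal.ofReal ((d : ℝ) ^ β / (1 - r)) * ∫⁻ x, ∫⁻ y, edist x y ^ (-β) ∂ν ∂ν := by
    rw [← lintegral_const_mul' _ _ ENNReal.ofReal_ne_top]
    refine lintegral_mono_ae ?_
    filter_upwards [hae] with x hx
    rw [← lintegral_const_mul' _ _ ENNReal.ofReal_ne_top]
    refine lintegral_mono_ae ?_
    filter_upwards [hae] with y hy
    exact levelKernel_index_le hd hr0 hr1 hβ0 hβ (hΛ x hx) (hΛ y hy)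
  have hK0 := (conductance_mem hr0 (meeting n Λ) n 0).1
  calc (1 : ℝ≥0∞) = ENNReal.ofReal 1 := by simp
    _ ≤ _ := ENNReal.ofReal_le_ofReal h1
    _ = ENNReal.ofReal (conductance r (meeting n Λ) n 0) * _ := ENNReal.ofReal_mul hK0
    _ ≤ _ := mul_le_mul' ?_ (h3.trans h4)
  rw [law_hit ⟨hr0.le, hr1.le⟩]
  exact ENNReal.ofReal_le_ofReal (conductance_le_hitProb hr0 hr1 _ _ _)

theorem capacity_le_law_percolation_hit (hd : 1 ≤ d) {r β : ℝ} (hr0 : 0 < r) (hr1 : r < 1)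
    (hβ0 : 0 < β) (hβ : (2 : ℝ) ^ β = r⁻¹) {Λ : Set (EuclideanSpace ℝ (Fin d))}
    (hΛc : IsClosed Λ) (hΛ : ∀ x ∈ Λ, ∀ i, x i ∈ Set.Icc (-(1 / 2) : ℝ) (1 / 2)) :
    capacity β Λ ≤ ENNReal.ofReal ((d : ℝ) ^ β / (1 - r)) *
      law d r {ω | (percolation ω ∩ Λ).Nonempty} := by
  set C := ENNReal.ofReal ((d : ℝ) ^ β / (1 - r)) with hC
  have hC0 : C ≠ 0 := by
    have : (0 : ℝ) < d := by exact_mod_cast hd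
    have : 0 < 1 - r := by linarith
    exact (ENNReal.ofReal_pos.2 (by positivity)).ne'
  have hCt : C ≠ ⊤ := ENNReal.ofReal_ne_top
  rw [capacity]
  simp only [ENNReal.inv_iInf, iSup_le_iff]
  intro ν hν hνΛ
  set I := ∫⁻ x, ∫⁻ y, edist x y ^ (-β) ∂ν ∂ν with hI
  have hkey : (C * I)⁻¹ ≤ law d r {ω | (percolation ω ∩ Λ).Nonempty} := by
    refine le_law_percolation_hit hΛc fun n _ => ?_
    have h := one_le_law_hit_mul_energy hd hr0 hr1 hβ0 hβ hΛ ν hνΛ n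
    rw [← hI, ← hC] at h
    rcases eq_or_ne (C * I) ⊤ with ht | ht
    · simp [ht]
    · have h0 : C * I ≠ 0 := by
        intro h0; rw [h0, mul_zero] at h; exact absurd h (by simp)
      rw [← one_div]
      exact ENNReal.div_le_of_le_mul h
  calc I⁻¹ = C * (C * I)⁻¹ := by
        rw [ENNReal.mul_inv (.inl hC0) (.inl hCt), ← mul_assoc, ENNReal.mul_inv_cancel hC0 hCt,
          one_mul]
    _ ≤ _ := by gcongr

/-! ### The hitting probability bounds the capacity from below -/

/-- An open neighbourhood of the cube `v` of generation `j`. -/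
def nbhd (j : ℕ) (v : Fin d → ℕ) : Set (EuclideanSpace ℝ (Fin d)) :=
  {x | ∀ i, |2 ^ j * (x i + 1 / 2) - (v i + 1 / 2)| < 2}

lemma isOpen_nbhd (j : ℕ) (v : Fin d → ℕ) : IsOpen (nbhd j v) := by
  have : nbhd j v = ⋂ i, {x : EuclideanSpace ℝ (Fin d) |
      |(2 : ℝ) ^ j * (x i + 1 / 2) - (v i + 1 / 2)| < 2} := by
    ext x; simp [nbhd]
  rw [this]
  exact isOpen_iInter_of_finite fun i => isOpen_lt (by fun_prop) (by fun_prop)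

lemma near_of_mem_nbhd {n j : ℕ} (hj : j ≤ n) {b v : Fin d → ℕ} {x : EuclideanSpace ℝ (Fin d)}
    (hx : x ∈ closure (cube n b)) (hv : x ∈ nbhd j v) : Near v (anc (n - j) b) := by
  intro i
  have hx' : x ∈ closure (cube (j + (n - j)) b) := by rwa [Nat.add_sub_cancel' hj]
  have h1 := mem_closure_cube.1 (closure_cube_subset b hx') i
  have h2 := abs_lt.1 (hv i)
  set w := anc (n - j) b i
  have h3 : ((v i : ℤ) : ℝ) - (w : ℤ) < (3 : ℤ) := by push_cast; linarith
  have h4 : ((-3 : ℤ) : ℝ) < ((v i : ℤ) : ℝ) - (w : ℤ) := by push_cast; linarith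
  have h5 : (v i : ℤ) - w < 3 := by exact_mod_cast h3
  have h6 : -3 < (v i : ℤ) - w := by exact_mod_cast h4
  rw [abs_le]
  omega

/-- One scale suffices off the diagonal: if 2^(-j-1) < |x-y| ≤ 2^(-j), both points lie in the
enlarged cube around x, which contributes r^(-j) = 2^(jβ), and the factor 2^β covers the rounding.
Distances above 1 are handled by the root. Enlarging the cubes is necessary because arbitrarily
close points may lie in different cubes. -/
lemma edist_rpow_le_levelKernel {r β : ℝ} (hr0 : 0 < r) (hr1 : r < 1) (hβ0 : 0 < β)
    (hβ : (2 : ℝ) ^ β = r⁻¹) {x y : EuclideanSpace ℝ (Fin d)}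
    (hx : ∀ i, x i ∈ Set.Icc (-(1 / 2) : ℝ) (1 / 2))
    (hy : ∀ i, y i ∈ Set.Icc (-(1 / 2) : ℝ) (1 / 2)) :
    edist x y ^ (-β) ≤ ENNReal.ofReal (2 ^ β) * levelKernel r nbhd x y := by
  have hterm : ∀ j, (dist x y ≤ 1 / 2 ^ j ∨ j = 0) → ENNReal.ofReal (r ^ j)⁻¹ ≤
      ∑ v ∈ desc j (0 : Fin d → ℕ), ENNReal.ofReal (r ^ j)⁻¹ *
        ((nbhd j v).indicator 1 x * (nbhd j v).indicator 1 y) := by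
    intro j hj
    have hT : (0 : ℝ) < 2 ^ j := by positivity
    have hxc := mem_closure_cube.1 (mem_closure_cube_index hx j)
    have h1 : x ∈ nbhd j (index j x) := by
      intro i
      have := hxc i
      rw [abs_lt]
      constructor <;> linarith
    have h2 : y ∈ nbhd j (index j x) := by
      intro i
      rcases hj with hj | rfl
      · have hle : |y i - x i| ≤ 1 / 2 ^ j := by
          refine le_trans ?_ hj
          rw [dist_comm, dist_eq_norm, ← Real.norm_eq_abs]
          exact PiLp.norm_apply_le (y - x) i
        rw [le_div_iff₀ hT, ← abs_of_pos hT, ← abs_mul, abs_le] at hle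
        have := hxc i
        rw [abs_lt]
        constructor <;> linarith
      · have h0 : index 0 x = 0 := by simpa [desc_zero] using index_mem_box 0 x
        obtain ⟨h3, h4⟩ := hy i
        simp only [h0, pow_zero, Pi.zero_apply, Nat.cast_zero, one_mul]
        rw [abs_lt]
        constructor <;> linarith
    refine le_trans ?_ (Finset.single_le_sum (fun v _ => zero_le) (index_mem_box j x))
    simp [h1, h2]
  have hle : ∀ j, (dist x y ≤ 1 / 2 ^ j ∨ j = 0) →
      ENNReal.ofReal (r ^ j)⁻¹ ≤ levelKernel r nbhd x y := fun j hj =>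
    (hterm j hj).trans (ENNReal.le_tsum j)
  have h2 : (1 : ℝ) ≤ 2 ^ β := Real.one_le_rpow (by norm_num) hβ0.le
  rcases eq_or_ne x y with rfl | hxy
  · have : levelKernel r nbhd x x = ⊤ := by
      -- On the diagonal every scale contributes at least 1, so the kernel diverges as required.
      rw [← top_le_iff, ← ENNReal.tsum_const_eq_top_of_ne_zero (α := ℕ) one_ne_zero]
      refine ENNReal.tsum_le_tsum fun j => le_trans ?_ (hterm j (.inl (by simp)))
      rw [← ENNReal.ofReal_one]
      exact ENNReal.ofReal_le_ofReal ((one_le_inv₀ (by positivity)).2 (pow_le_one₀ hr0.le hr1.le))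
    rw [this, ENNReal.mul_top (ENNReal.ofReal_pos.2 (by positivity)).ne']
    exact le_top
  have hδ : 0 < dist x y := dist_pos.2 hxy
  rw [edist_dist, ENNReal.ofReal_rpow_of_pos hδ]
  rcases le_total (dist x y) 1 with h1 | h1
  · obtain ⟨j, hj1, hj2⟩ := exists_nat_pow_near_of_lt_one hδ h1 (show (0 : ℝ) < 1 / 2 by norm_num)
      (by norm_num)
    refine le_trans ?_ (mul_le_mul_right (hle j (.inl ?_)) _)
    · rw [← ENNReal.ofReal_mul (by positivity)]
      refine ENNReal.ofReal_le_ofReal ?_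
      rw [inv_pow_eq_rpow hβ, ← Real.mul_rpow (by norm_num) (by positivity), ← pow_succ',
        Real.rpow_neg hδ.le, ← Real.inv_rpow hδ.le]
      refine Real.rpow_le_rpow (by positivity) ?_ hβ0.le
      rw [inv_le_comm₀ hδ (by positivity), ← one_div, ← one_div_pow]
      exact hj1.le
    · rwa [one_div_pow] at hj2
  · refine le_trans ?_ (mul_le_mul_right (hle 0 (.inr rfl)) _)
    rw [← ENNReal.ofReal_mul (by positivity)]
    refine ENNReal.ofReal_le_ofReal ?_
    have := Real.rpow_le_one_of_one_le_of_nonpos h1 (show -β ≤ 0 by linarith)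
    simp only [pow_zero, inv_one, mul_one]
    linarith

/-- The equilibrium flow gives a probability measure on `Λ` with small energy up to scale `n`. -/
lemma exists_measure_energy_le {r : ℝ} (hr0 : 0 < r) {Λ : Set (EuclideanSpace ℝ (Fin d))}
    [Nonempty Λ] (n : ℕ) (hK : 0 < conductance r (meeting n Λ) n 0) :
    ∃ ν : ProbabilityMeasure Λ, ∀ J ≤ n, ∑ j ∈ Finset.range (J + 1),
      ∑ v ∈ desc j (0 : Fin d → ℕ), ENNReal.ofReal (r ^ j)⁻¹ *
        (ν : Measure Λ) (Subtype.val ⁻¹' nbhd j v) ^ 2 ≤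
      ENNReal.ofReal (25 ^ d / conductance r (meeting n Λ) n 0) := by
  classical
  set B := meeting n Λ with hB
  set K := conductance r B n 0 with hKdef
  set μ : (Fin d → ℕ) → ℝ := fun b => r ^ n * potential r B n 0 b with hμ
  have hμ0 : ∀ b, 0 ≤ μ b := fun b => mul_nonneg (by positivity) (potential_nonneg hr0 B n 0 b)
  have hpt : ∀ b, ∃ x : Λ, b ∈ B → (x : EuclideanSpace ℝ (Fin d)) ∈ closure (cube n b) := by
    intro b
    by_cases hb : b ∈ B
    · obtain ⟨-, x, hx, hxΛ⟩ := hb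
      exact ⟨⟨x, hxΛ⟩, fun _ => hx⟩
    · exact ⟨Classical.arbitrary _, fun h => absurd h hb⟩
  choose pt hpt using hpt
  -- The normalized equilibrium flow, with the mass of each leaf b of B placed at one chosen point
  -- of Λ in the closed cube b.
  set m : Measure Λ := ∑ b ∈ desc n (0 : Fin d → ℕ), ENNReal.ofReal (μ b / K) • Measure.dirac (pt b)
    with hm
  have hmU : ∀ U : Set Λ, MeasurableSet U → m U = ∑ b ∈ desc n (0 : Fin d → ℕ),
      ENNReal.ofReal (μ b / K) * U.indicator 1 (pt b) := by
    intro U hU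
    simp [hm, Measure.finsetSum_apply, Measure.dirac_apply' _ hU]
  have hm1 : IsProbabilityMeasure m := by
    refine ⟨?_⟩
    rw [hmU _ MeasurableSet.univ]
    simp only [Set.indicator_univ, Pi.one_apply, mul_one]
    rw [← ENNReal.ofReal_sum_of_nonneg fun b _ => div_nonneg (hμ0 b) hK.le, ← Finset.sum_div,
      sum_flow hr0 B n 0, ← hKdef, div_self hK.ne', ENNReal.ofReal_one]
  refine ⟨⟨m, hm1⟩, fun J hJ => ?_⟩
  set f : ℕ → (Fin d → ℕ) → ℝ := fun j w => (∑ b ∈ desc (n - j) w, μ b) / K with hf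
  have hf0 : ∀ j w, 0 ≤ f j w := fun j w =>
    div_nonneg (Finset.sum_nonneg fun b _ => hμ0 b) hK.le
  -- An enlarged cube only receives mass from leaves whose ancestor is near v.
  have hmle : ∀ j ≤ n, ∀ v, m (Subtype.val ⁻¹' nbhd j v) ≤
      ENNReal.ofReal (∑ w ∈ (desc j (0 : Fin d → ℕ)).filter (Near v), f j w) := by
    intro j hj v
    rw [hmU _ ((isOpen_nbhd j v).preimage continuous_subtype_val).measurableSet]
    have e : ∑ w ∈ (desc j (0 : Fin d → ℕ)).filter (Near v), f j w =
        ∑ b ∈ desc n (0 : Fin d → ℕ), if Near v (anc (n - j) b) then μ b / K else 0 := by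
      rw [show desc n (0 : Fin d → ℕ) = desc ((n - j) + j) 0 by rw [Nat.sub_add_cancel hj],
        sum_desc_add, Finset.sum_filter]
      refine Finset.sum_congr rfl fun w _ => ?_
      split_ifs with h
      · rw [hf]
        simp only
        rw [Finset.sum_div]
        refine Finset.sum_congr rfl fun b hb => ?_
        rw [mem_desc] at hb
        rw [hb, if_pos h]
      · symm
        refine Finset.sum_eq_zero fun b hb => ?_
        rw [mem_desc] at hb
        rw [hb, if_neg h]
    rw [e, ENNReal.ofReal_sum_of_nonneg fun b _ => by
      split_ifs
      · exact div_nonneg (hμ0 b) hK.le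
      · exact le_rfl]
    refine Finset.sum_le_sum fun b _ => ?_
    by_cases hb : b ∈ B
    · by_cases hx : pt b ∈ (Subtype.val ⁻¹' nbhd j v : Set Λ)
      · rw [if_pos (near_of_mem_nbhd hj (hpt b hb) hx)]
        simp [Set.indicator_of_mem hx]
      · simp [Set.indicator_of_notMem hx]
    · simp [hμ, potential_zero_of_notMem B n hb]
  have hlevel : ∀ j ≤ n, ∑ v ∈ desc j (0 : Fin d → ℕ), ENNReal.ofReal (r ^ j)⁻¹ *
        m (Subtype.val ⁻¹' nbhd j v) ^ 2 ≤
      ENNReal.ofReal (25 ^ d * ∑ v ∈ desc j (0 : Fin d → ℕ), (r ^ j)⁻¹ * f j v ^ 2) := by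
    intro j hj
    -- Cauchy–Schwarz over the near cubes costs 5^d, and exchanging the order of summation costs
    -- another 5^d; together they give 25^d.
    have h1 : ∀ v, (∑ w ∈ (desc j (0 : Fin d → ℕ)).filter (Near v), f j w) ^ 2 ≤
        5 ^ d * ∑ w ∈ (desc j (0 : Fin d → ℕ)).filter (Near v), f j w ^ 2 := by
      intro v
      refine sq_sum_le_card_mul_sum_sq.trans (mul_le_mul_of_nonneg_right ?_
        (Finset.sum_nonneg fun w _ => sq_nonneg _))
      exact_mod_cast card_near_le (desc j (0 : Fin d → ℕ)) v
    have h2 := sum_near_sq_le (desc j (0 : Fin d → ℕ)) (f j)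
    calc _ ≤ ∑ v ∈ desc j (0 : Fin d → ℕ), ENNReal.ofReal ((r ^ j)⁻¹ *
          (∑ w ∈ (desc j (0 : Fin d → ℕ)).filter (Near v), f j w) ^ 2) := by
          refine Finset.sum_le_sum fun v _ => ?_
          rw [ENNReal.ofReal_mul (by positivity),
            ENNReal.ofReal_pow (Finset.sum_nonneg fun w _ => hf0 j w)]
          gcongr
          exact hmle j hj v
      _ = ENNReal.ofReal (∑ v ∈ desc j (0 : Fin d → ℕ), (r ^ j)⁻¹ *
          (∑ w ∈ (desc j (0 : Fin d → ℕ)).filter (Near v), f j w) ^ 2) := by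
          rw [ENNReal.ofReal_sum_of_nonneg fun v _ => by positivity]
      _ ≤ _ := by
          refine ENNReal.ofReal_le_ofReal ?_
          rw [← Finset.mul_sum, ← Finset.mul_sum, mul_left_comm]
          refine mul_le_mul_of_nonneg_left ?_ (by positivity)
          refine (Finset.sum_le_sum fun v _ => h1 v).trans ?_
          rw [← Finset.mul_sum, show (25 : ℝ) = 5 * 5 by norm_num, mul_pow, mul_assoc]
          exact mul_le_mul_of_nonneg_left h2 (by positivity)
  have hsum : ∑ j ∈ Finset.range (n + 1), ∑ v ∈ desc j (0 : Fin d → ℕ), (r ^ j)⁻¹ * f j v ^ 2 =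
      K⁻¹ := by
    have h1 : ∑ j ∈ Finset.range (n + 1), ∑ v ∈ desc j (0 : Fin d → ℕ), (r ^ j)⁻¹ * f j v ^ 2 =
        ∑ h ∈ Finset.range (n + 1), ∑ v ∈ desc (n - h) (0 : Fin d → ℕ),
          r ^ (n - h) * potential r B n h v ^ 2 / K ^ 2 := by
      rw [← Finset.sum_range_reflect]
      refine Finset.sum_congr rfl fun h hh => ?_
      rw [Finset.mem_range] at hh
      rw [show n + 1 - 1 - h = n - h by omega]
      refine Finset.sum_congr rfl fun v _ => ?_
      simp only [hf]
      rw [show n - (n - h) = h by omega, hμ, sum_leaves_potential hr0 B n (by omega)]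
      field_simp
    rw [h1]
    simp_rw [← Finset.sum_div]
    rw [energy_potential hr0, ← hKdef]
    field_simp
  refine (Finset.sum_le_sum fun j hj => hlevel j (by
    have := Finset.mem_range.1 hj; omega)).trans ?_
  rw [← ENNReal.ofReal_sum_of_nonneg fun j _ => mul_nonneg (by positivity)
    (Finset.sum_nonneg fun v _ => by positivity), ← Finset.mul_sum, div_eq_mul_inv, ← hsum]
  refine ENNReal.ofReal_le_ofReal (mul_le_mul_of_nonneg_left ?_ (by positivity))
  refine Finset.sum_le_sum_of_subset_of_nonneg ?_ fun j _ _ =>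
    Finset.sum_nonneg fun v _ => by positivity
  exact Finset.range_subset_range.2 (by omega)

open Filter Topology in
/-- A weak limit point of a sequence of probability measures on a compact set inherits bounds on
energies at finitely many scales. -/
lemma exists_limit_measure {X : Type*} [TopologicalSpace X] [CompactSpace X] [MeasurableSpace X]
    [BorelSpace X] [T2Space X] [HasOuterApproxClosed X] [CompactSpace (ProbabilityMeasure X)]
    {ι : Type*} (ν : ℕ → ProbabilityMeasure X) (S : ℕ → Finset ι) (a : ι → ℝ≥0∞)
    (ha : ∀ i, a i ≠ ⊤) (U : ι → Set X) (hU : ∀ i, IsOpen (U i)) (c : ℝ≥0∞)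
    (h : ∀ J, ∀ n ≥ J, ∑ i ∈ S J, a i * (ν n : Measure X) (U i) ^ 2 ≤ c) :
    ∃ ν' : ProbabilityMeasure X, ∀ J, ∑ i ∈ S J, a i * (ν' : Measure X) (U i) ^ 2 ≤ c := by
  obtain ⟨ν', -, hν'⟩ := (isCompact_univ (X := ProbabilityMeasure X)).ultrafilter_le_nhds
    ((hyperfilter ℕ).map ν) (by simp)
  have hlim : ∀ i, ∃ l, Tendsto (fun n => (ν n : Measure X) (U i)) (hyperfilter ℕ) (𝓝 l) := by
    intro i
    obtain ⟨l, -, hl⟩ := (isCompact_univ (X := ℝ≥0∞)).ultrafilter_le_nhds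
      ((hyperfilter ℕ).map fun n => (ν n : Measure X) (U i)) (by simp)
    exact ⟨l, hl⟩
  choose l hl using hlim
  refine ⟨ν', fun J => ?_⟩
  have hν' : Tendsto ν (hyperfilter ℕ) (𝓝 ν') := hν'
  -- Portmanteau for open sets: mass can only drop in the limit, so the upper bounds on the energies
  -- survive. This is why the enlarged cubes are taken open.
  have hle : ∀ i, (ν' : Measure X) (U i) ≤ l i := fun i => by
    have := ProbabilityMeasure.le_liminf_measure_open_of_tendsto (μs := ν) hν' (hU i)
    rwa [(hl i).liminf_eq] at this
  refine (Finset.sum_le_sum fun i _ => mul_le_mul_right (pow_le_pow_left' (hle i) 2) _).trans ?_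
  refine le_of_tendsto (x := (hyperfilter ℕ : Filter ℕ)) (tendsto_finsetSum _ fun i _ =>
    ENNReal.Tendsto.const_mul (ENNReal.Tendsto.pow (hl i)) (.inr (ha i))) ?_
  exact Nat.hyperfilter_le_atTop ((eventually_ge_atTop J).mono fun n hn => h J n hn)

theorem law_percolation_hit_le_capacity {r β : ℝ} (hr0 : 0 < r) (hr1 : r < 1) (hβ0 : 0 < β)
    (hβ : (2 : ℝ) ^ β = r⁻¹) {Λ : Set (EuclideanSpace ℝ (Fin d))} (hΛc : IsClosed Λ)
    (hΛ : ∀ x ∈ Λ, ∀ i, x i ∈ Set.Icc (-(1 / 2) : ℝ) (1 / 2)) :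
    law d r {ω | (percolation ω ∩ Λ).Nonempty} ≤
      ENNReal.ofReal (2 ^ β * 25 ^ d * (2 / (1 - r))) * capacity β Λ := by
  have hr2 : 0 < 1 - r := by linarith
  set P := law d r {ω | (percolation ω ∩ Λ).Nonempty} with hP
  rcases eq_or_ne P 0 with hP0 | hP0
  · rw [hP0]; exact zero_le
  have hPt : P ≠ ⊤ := measure_ne_top _ _
  have hκ : 0 < P.toReal := ENNReal.toReal_pos hP0 hPt
  set κ := P.toReal
  have hΛne : Nonempty Λ := by
    obtain ⟨ω, x, -, hx⟩ := nonempty_of_measure_ne_zero hP0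
    exact ⟨⟨x, hx⟩⟩
  -- The continuous hitting probability bounds all finite-level conductances from below, so the
  -- discretized measures have uniformly bounded energies.
  have hK : ∀ n, (1 - r) / 2 * κ ≤ conductance r (meeting (n + 1) Λ) (n + 1) 0 := by
    intro n
    have h1 : P ≤ ENNReal.ofReal (hitProb r (meeting (n + 1) Λ) (n + 1) 0) := by
      rw [← law_hit ⟨hr0.le, hr1.le⟩]
      exact law_percolation_hit_le hΛc (by omega)
    have h2 := ENNReal.toReal_le_of_le_ofReal (hitProb_mem hr0 hr1 _ _ _).1 h1
    have h3 := h2.trans (hitProb_le hr0 hr1 _ _ _)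
    rw [div_mul_eq_mul_div, le_div_iff₀ hr2] at h3
    linarith
  have hκ' : 0 < (1 - r) / 2 * κ := by positivity
  have hcompact : IsCompact Λ := by
    have : Λ ⊆ closure (cube 0 0) := fun x hx => by
      have h0 : index 0 x = 0 := by simpa [desc_zero] using index_mem_box 0 x
      exact h0 ▸ mem_closure_cube_index (hΛ x hx) 0
    exact (isCompact_closure_cube 0 0).of_isClosed_subset hΛc this
  have : CompactSpace Λ := isCompact_iff_compactSpace.1 hcompact
  choose ν hν using fun n => exists_measure_energy_le hr0 (Λ := Λ) (n + 1) (hκ'.trans_le (hK n))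
  obtain ⟨ν', hν'⟩ := exists_limit_measure ν
    (fun J => (Finset.range (J + 1)).sigma fun j => desc j (0 : Fin d → ℕ))
    (fun x => ENNReal.ofReal (r ^ x.1)⁻¹) (fun _ => ENNReal.ofReal_ne_top)
    (fun x => Subtype.val ⁻¹' nbhd x.1 x.2)
    (fun x => (isOpen_nbhd x.1 x.2).preimage continuous_subtype_val)
    (ENNReal.ofReal (25 ^ d / ((1 - r) / 2 * κ)))
    (fun J n hn => by
      rw [Finset.sum_sigma]
      refine (hν n J (by omega)).trans (ENNReal.ofReal_le_ofReal ?_)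
      exact div_le_div_of_nonneg_left (by positivity) hκ' (hK n))
  set ρ : Measure (EuclideanSpace ℝ (Fin d)) := (ν' : Measure Λ).map Subtype.val with hρ
  have hρ1 : IsProbabilityMeasure ρ :=
    Measure.isProbabilityMeasure_map measurable_subtype_coe.aemeasurable
  have hρΛ : ρ Λᶜ = 0 := by
    rw [hρ, Measure.map_apply measurable_subtype_coe hΛc.measurableSet.compl]
    simp
  have hae : ∀ᵐ x ∂ρ, x ∈ Λ := by rwa [ae_iff]
  have hI : ∫⁻ x, ∫⁻ y, edist x y ^ (-β) ∂ρ ∂ρ ≤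
      ENNReal.ofReal (2 ^ β) * ENNReal.ofReal (25 ^ d / ((1 - r) / 2 * κ)) := by
    calc _ ≤ ENNReal.ofReal (2 ^ β) * ∫⁻ x, ∫⁻ y, levelKernel r nbhd x y ∂ρ ∂ρ := by
          rw [← lintegral_const_mul' _ _ ENNReal.ofReal_ne_top]
          refine lintegral_mono_ae ?_
          filter_upwards [hae] with x hx
          rw [← lintegral_const_mul' _ _ ENNReal.ofReal_ne_top]
          refine lintegral_mono_ae ?_
          filter_upwards [hae] with y hy
          exact edist_rpow_le_levelKernel hr0 hr1 hβ0 hβ (hΛ x hx) (hΛ y hy)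
      _ ≤ _ := by
          rw [lintegral_levelKernel r fun k v => (isOpen_nbhd k v).measurableSet]
          refine mul_le_mul_right (ENNReal.tsum_le_of_sum_range_le fun N => ?_) _
          refine le_trans ?_ (hν' N)
          rw [Finset.sum_sigma]
          refine (Finset.sum_le_sum_of_subset (Finset.range_subset_range.2 (Nat.le_succ N))).trans
            (le_of_eq ?_)
          refine Finset.sum_congr rfl fun j _ => Finset.sum_congr rfl fun v _ => ?_
          rw [hρ, Measure.map_apply measurable_subtype_coe (isOpen_nbhd j v).measurableSet]
  have hcap : (ENNReal.ofReal (2 ^ β) * ENNReal.ofReal (25 ^ d / ((1 - r) / 2 * κ)))⁻¹ ≤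
      capacity β Λ := by
    rw [capacity]
    exact ENNReal.inv_le_inv.2 ((iInf_le_of_le ρ (iInf_le_of_le hρ1 (iInf_le_of_le hρΛ le_rfl))).trans
      hI)
  refine le_trans (le_of_eq ?_) (mul_le_mul_right hcap _)
  rw [← ENNReal.ofReal_mul (by positivity), ← ENNReal.ofReal_inv_of_pos (by positivity),
    ← ENNReal.ofReal_mul (by positivity), ← ENNReal.ofReal_toReal hPt]
  congr 1
  change κ = _
  field_simp

end FractalPercolation

/-! ### Assembling the estimates -/

theorem corollary3 (d : ℕ) (hd : 1 ≤ d) (p q : ℝ)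
    (hp : p ∈ Set.Ioo (0 : ℝ) 1) (hq : q ∈ Set.Ioo (0 : ℝ) 1)
    (hp' : ((2 : ℝ) ^ d)⁻¹ < p) (hq' : ((2 : ℝ) ^ d)⁻¹ < q)
    (β : ℝ) (hβ : β = -Real.logb 2 (2 ^ d * p * q)) (hβ' : 0 < β) :
    -- the discrete percolations
    (∃ C₁ C₂ : ℝ≥0, 0 < C₁ ∧ 0 < C₂ ∧ ∀ n : ℕ, 1 ≤ n → ∀ A : Set (Fin d → ℤ),
      (∀ a ∈ A, ∀ i, -2 ^ (n - 1) ≤ a i ∧ a i < 2 ^ (n - 1)) →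
      C₁ * FractalPercolation.law d (2 ^ d * p * q)
            {ω | (FractalPercolation.discretePercolation ω n ∩ A).Nonempty} ≤
        ((FractalPercolation.law d p).prod (FractalPercolation.law d q))
            {ω | ((FractalPercolation.discretePercolation ω.1 n +
              FractalPercolation.discretePercolation ω.2 n) ∩ A).Nonempty} ∧
      ((FractalPercolation.law d p).prod (FractalPercolation.law d q))
            {ω | ((FractalPercolation.discretePercolation ω.1 n +
              FractalPercolation.discretePercolation ω.2 n) ∩ A).Nonempty} ≤
        C₂ * FractalPercolation.law d (2 ^ d * p * q)
            {ω | (FractalPercolation.discretePercolation ω n ∩ A).Nonempty}) ∧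
    -- the continuous percolations
    (∃ C₁ C₂ C₃ C₄ : ℝ≥0, 0 < C₁ ∧ 0 < C₂ ∧ 0 < C₃ ∧ 0 < C₄ ∧
      ∀ Λ : Set (EuclideanSpace ℝ (Fin d)), IsClosed Λ →
      (∀ x ∈ Λ, ∀ i, x i ∈ Set.Icc (-(1 / 2) : ℝ) (1 / 2)) →
      C₁ * FractalPercolation.capacity β Λ ≤
        ((FractalPercolation.law d p).prod (FractalPercolation.law d q))
            {ω | ((FractalPercolation.percolation ω.1 +
              FractalPercolation.percolation ω.2) ∩ Λ).Nonempty} ∧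
      ((FractalPercolation.law d p).prod (FractalPercolation.law d q))
            {ω | ((FractalPercolation.percolation ω.1 +
              FractalPercolation.percolation ω.2) ∩ Λ).Nonempty} ≤
        C₂ * FractalPercolation.capacity β Λ ∧
      C₃ * FractalPercolation.law d (2 ^ d * p * q)
            {ω | (FractalPercolation.percolation ω ∩ Λ).Nonempty} ≤
        FractalPercolation.capacity β Λ ∧
      FractalPercolation.capacity β Λ ≤
        C₄ * FractalPercolation.law d (2 ^ d * p * q)
            {ω | (FractalPercolation.percolation ω ∩ Λ).Nonempty}) := by
  have hp0 := hp.1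
  have hq0 := hq.1
  set r : ℝ := 2 ^ d * p * q with hr
  have hr0 : 0 < r := by positivity
  have hβr : (2 : ℝ) ^ β = r⁻¹ := by
    rw [hβ, Real.rpow_neg two_pos.le, Real.rpow_logb two_pos (by norm_num) hr0]
  have hr1 : r < 1 := by
    have := Real.one_lt_rpow (x := 2) (by norm_num) hβ'
    rw [hβr] at this
    exact (one_lt_inv₀ hr0).1 this
  have hr2 : 0 < 1 - r := by linarith
  have hp2 : 0 < 1 - p := by linarith [hp.2]
  have hD : (0 : ℝ) < 2 ^ d := by positivity
  have hpD : 1 < 2 ^ d * p := by rwa [inv_lt_iff_one_lt_mul₀' hD] at hp'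
  have hqD : 1 < 2 ^ d * q := by rwa [inv_lt_iff_one_lt_mul₀' hD] at hq'
  set a : ℝ := (4 ^ d * 5 ^ d * ((1 - (2 ^ d * p)⁻¹)⁻¹ + (1 - (2 ^ d * q)⁻¹)⁻¹))⁻¹ *
    ((1 - r) / 2) with ha
  have ha0 : 0 < a := by
    have h1 := inv_pos.2 (sub_pos.2 (inv_lt_one_of_one_lt₀ hpD))
    have h2 := inv_pos.2 (sub_pos.2 (inv_lt_one_of_one_lt₀ hqD))
    positivity
  set b : ℝ := 2 / (1 - p) * 9 ^ d with hb
  have hb0 : 0 < b := by positivity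
  set e : ℝ := (d : ℝ) ^ β / (1 - r) with he
  have he0 : 0 < e := by
    have : (0 : ℝ) < d := by exact_mod_cast hd
    positivity
  set f : ℝ := 2 ^ β * 25 ^ d * (2 / (1 - r)) with hf
  have hf0 : 0 < f := by positivity
  have hsub : ∀ n (A : Set (Fin d → ℤ)), FractalPercolation.latticeIndices n A ⊆
      FractalPercolation.desc n (0 : Fin d → ℕ) := fun n A c hc => hc.1
  have hsub' : ∀ n (Λ : Set (EuclideanSpace ℝ (Fin d))), FractalPercolation.meeting n Λ ⊆
      FractalPercolation.desc n (0 : Fin d → ℕ) := fun n Λ c hc => hc.1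
  constructor
  · refine ⟨a.toNNReal, b.toNNReal, Real.toNNReal_pos.2 ha0, Real.toNNReal_pos.2 hb0,
      fun n hn A hA => ?_⟩
    rw [FractalPercolation.discretePercolation_sum_hit hn A hA,
      FractalPercolation.discretePercolation_hit hn A]
    exact ⟨FractalPercolation.law_hit_le_law_sumHit hp hq hr hr1 hpD hqD hn _,
      (MeasureTheory.measure_mono (FractalPercolation.sumHit_subset hn _)).trans
        (FractalPercolation.law_sum_hit_le hp hq hr hr1 n _ (hsub n A))⟩
  · refine ⟨(a / e).toNNReal, (b * f).toNNReal, (f⁻¹).toNNReal, e.toNNReal,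
      Real.toNNReal_pos.2 (by positivity), Real.toNNReal_pos.2 (by positivity),
      Real.toNNReal_pos.2 (by positivity), Real.toNNReal_pos.2 he0, fun Λ hΛ hΛ' => ?_⟩
    have hcap := FractalPercolation.capacity_le_law_percolation_hit hd hr0 hr1 hβ' hβr hΛ hΛ'
    have hhit := FractalPercolation.law_percolation_hit_le_capacity hr0 hr1 hβ' hβr hΛ hΛ'
    have hlow : ENNReal.ofReal a *
        FractalPercolation.law d r {ω | (FractalPercolation.percolation ω ∩ Λ).Nonempty} ≤
        ((FractalPercolation.law d p).prod (FractalPercolation.law d q))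
          {ω | ((FractalPercolation.percolation ω.1 +
            FractalPercolation.percolation ω.2) ∩ Λ).Nonempty} :=
      FractalPercolation.le_law_sum_percolation_hit hΛ fun n hn =>
        (mul_le_mul_right (FractalPercolation.law_percolation_hit_le hΛ hn) _).trans
          (FractalPercolation.law_hit_le_law_sumHit hp hq hr hr1 hpD hqD hn _)
    have hupp : ((FractalPercolation.law d p).prod (FractalPercolation.law d q))
          {ω | ((FractalPercolation.percolation ω.1 +
            FractalPercolation.percolation ω.2) ∩ Λ).Nonempty} ≤ ENNReal.ofReal b *
        FractalPercolation.law d r {ω | (FractalPercolation.percolation ω ∩ Λ).Nonempty} := by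
      have hb' : ENNReal.ofReal b ≠ 0 := (ENNReal.ofReal_pos.2 hb0).ne'
      -- The constant is moved to the left because passage to the limit in the generation needs a
      -- lower bound independent of n.
      rw [← ENNReal.div_le_iff' hb' ENNReal.ofReal_ne_top]
      refine FractalPercolation.le_law_percolation_hit hΛ fun n hn => ?_
      rw [ENNReal.div_le_iff' hb' ENNReal.ofReal_ne_top]
      exact (FractalPercolation.law_sum_percolation_hit_le hΛ hΛ' hn).trans
        (FractalPercolation.law_sum_hit_le hp hq hr hr1 n _ (hsub' n Λ))
    refine ⟨?_, ?_, ?_, hcap⟩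
    · change ENNReal.ofReal (a / e) * _ ≤ _
      refine le_trans ?_ hlow
      refine (mul_le_mul_right hcap _).trans (le_of_eq ?_)
      rw [← mul_assoc, ← ENNReal.ofReal_mul (by positivity), div_mul_cancel₀ _ he0.ne']
    · change _ ≤ ENNReal.ofReal (b * f) * _
      refine hupp.trans ((mul_le_mul_right hhit _).trans (le_of_eq ?_))
      rw [← mul_assoc, ← ENNReal.ofReal_mul hb0.le]
    · change ENNReal.ofReal f⁻¹ * _ ≤ _
      refine (mul_le_mul_right hhit _).trans (le_of_eq ?_)
      rw [← mul_assoc, ← ENNReal.ofReal_mul (by positivity), inv_mul_cancel₀ hf0.ne',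
        ENNReal.ofReal_one, one_mul]
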